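/- Let $k$ be a field and let $\mathscr C$ be an essentially small $k$-linear $\operatorname{Hom}$-finite triangulated category with split idempotents and suspension $\Sigma$. Let $w\ge 2$ be an integer and assume that $\mathscr C$ is $(-w)$-Calabi–Yau, i.e. there are $k$-linear isomorphisms $\mathscr C(x,y)\cong \operatorname{Hom}_k(\mathscr C(y,\Sigma^{-w}x),k)$ natural in $x$ and $y$. Notation. For classes of objects $\mathscr A,\mathscr B$, let $\mathscr A*\mathscr B$ be the class of objects $e$ for which there is a triangle $a\to e\to b\to\Sigma a$ with $a\in\mathscr A$, $b\in\mathscr B$. The extension closure of a class $\mathscr X$ is $\langle\mathscr X\rangle=\bigcup_{n\ge 0}(\mathscr X)_n$, where $(\mathscr X)_0=\{0\}$ and $(\mathscr X)_n=(\mathscr X)_{n-1}*(\mathscr X\cup\{0\})$. Put $\mathscr X^\perp=\{c\mid \mathscr C(x,c)=0 \text{ for all } x\in\mathscr X\}$. An $\mathscr X$-cover of $c$ is a morphism $\tau:x\to c$ with $x\in\mathscr X$ such that every morphism $x'\to c$ with $x'\in\mathscr X$ factors through $\tau$, and every endomorphism $g$ of $x$ with $\tau g=\tau$ is an automorphism.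 A finite set $\mathscr S=\{s_1,\dots,s_e\}$ of objects is a $w$-orthogonal collection if each $\mathscr C(s_i,s_i)$ is a skew field, $\mathscr C(s_i,s_j)=0$ for $i\ne j$, and $\mathscr C(s_i,\Sigma^{\ell}s_j)=0$ for all $i,j$ and all $\ell\in\{-w+1,\dots,-1\}$. It is a $w$-simple minded system if moreover $\mathscr C=\langle\mathscr S\rangle*\Sigma^{-1}\langle\mathscr S\rangle*\cdots*\Sigma^{-w+1}\langle\mathscr S\rangle$. A proper abelian subcategory of $\mathscr C$ is a full subcategory, closed under isomorphisms, finite direct sums and direct summands, which is abelian and whose short exact sequences are precisely the diagrams $a'\to a\to a''$ in it that extend to a triangle $a'\to a\to a''\to\Sigma a'$ of $\mathscr C$. A torsion pair in an abelian category is a pair $(\mathscr T,\mathscr F)$ of isomorphism-closed classes of objects with no nonzero morphisms from $\mathscr T$ to $\mathscr F$ such that each object $a$ has a short exact sequence $0\to t\to a\to f\to 0$ with $t\in\mathscr T$, $f\in\mathscr F$. Let $\mathscr S$ be a $w$-orthogonal collection in $\mathscr C$, let $\mathscr S'\subseteq\mathscr S$, and assume that each $s\in\mathscr S\setminus\mathscr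 S'$ has a $\Sigma^{-1}\langle\mathscr S'\rangle$-cover. The left tilt is $L_{\mathscr S'}(\mathscr S)=\{L_{\mathscr S'}(s)\mid s\in\mathscr S\}$, where $L_{\mathscr S'}(s)=\Sigma^{-1}s$ if $s\in\mathscr S'$, and, if $s\in\mathscr S\setminus\mathscr S'$, $L_{\mathscr S'}(s)$ is given by a triangle $\Sigma^{-1}t_s\xrightarrow{\tau_s}s\to L_{\mathscr S'}(s)\to t_s$ with $\tau_s$ a $\Sigma^{-1}\langle\mathscr S'\rangle$-cover. Such a left tilt exists, and for every choice of covers and triangles the left tilt and the classes $\mathscr T=\langle\mathscr S'\rangle$, $\mathscr F=\langle\mathscr S'\rangle^{\perp}\cap\langle\mathscr S\rangle$ have the following properties. (i) $L_{\mathscr S'}(\mathscr S)$ is a $w$-orthogonal collection. (ii) If $\mathscr S$ is a $w$-simple minded system, then so is $L_{\mathscr S'}(\mathscr S)$. (iii) $\langle\mathscr S\rangle$ is a proper abelian subcategory of $\mathscr C$, $(\mathscr T,\mathscr F)$ is a torsion pair in $\langle\mathscr S\rangle$, and $\mathscr T$ is closed under subobjects in $\langle\mathscr S\rangle$. (iv)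 $\langle L_{\mathscr S'}(\mathscr S)\rangle$ is a proper abelian subcategory of $\mathscr C$, $(\mathscr F,\Sigma^{-1}\mathscr T)$ is a torsion pair in $\langle L_{\mathscr S'}(\mathscr S)\rangle$, and $\Sigma^{-1}\mathscr T$ is closed under quotient objects in $\langle L_{\mathscr S'}(\mathscr S)\rangle$. -/

import Mathlib

open CategoryTheory CategoryTheory.Limits CategoryTheory.Pretriangulated

universe t u v

namespace SimpleMinded

section Triangulated

variable {C : Type u} [Category.{v} C] [Preadditive C] [HasZeroObject C] [HasShift C ℤ]
  [∀ n : ℤ, (shiftFunctor C n).Additive] [Pretriangulated C]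

/-- The class `Σⁿ P` of all objects isomorphic to `Σⁿ X` for some `X` in the class `P`. -/
def shiftClass (P : ObjectProperty C) (n : ℤ) : ObjectProperty C :=
  P.map (shiftFunctor C n)

/-- The classes `(P)₀ = {0}` and `(P)ₙ₊₁ = (P)ₙ * (P ∪ {0})`, where `*` is
`ObjectProperty.extensionProduct`: an object lies in `A * B` if it is the middle term of a
distinguished triangle `a ⟶ e ⟶ b ⟶ Σ a` with `a` in `A` and `b` in `B`. -/
def extIter (P : ObjectProperty C) : ℕ → ObjectProperty C
  | 0 => fun X => IsZero X
  | n + 1 => (extIter P n).extensionProduct (fun X => P X ∨ IsZero X)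

/-- The extension closure `⟨P⟩ = ⋃ₙ (P)ₙ` of a class of objects. -/
def extClosure (P : ObjectProperty C) : ObjectProperty C :=
  fun X => ∃ n : ℕ, extIter P n X

/-- The product `P * Σ⁻¹ P * ⋯ * Σ⁻ⁿ⁺¹ P` with `n` factors (the empty product being `{0}`). -/
def negTower (P : ObjectProperty C) : ℕ → ObjectProperty C
  | 0 => fun X => IsZero X
  | n + 1 => (negTower P n).extensionProduct (shiftClass P (-(n : ℤ)))

/-- A finite family `s` of objects is a `w`-orthogonal collection: the endomorphism rings are
skew fields, there are no nonzero morphisms between different members, and there are no nonzero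
morphisms `sᵢ ⟶ Σˡ sⱼ` for `l ∈ {-w+1, …, -1}`. -/
structure IsOrthogonalCollection (w : ℕ) {ι : Type*} (s : ι → C) : Prop where
  finite : Finite ι
  nontrivial_end : ∀ i, Nontrivial (s i ⟶ s i)
  isIso_of_ne_zero : ∀ i (f : s i ⟶ s i), f ≠ 0 → IsIso f
  hom_eq_zero : ∀ i j, i ≠ j → ∀ f : s i ⟶ s j, f = 0
  hom_shift_eq_zero : ∀ i j (l : ℤ), -(w : ℤ) + 1 ≤ l → l ≤ -1 →
    ∀ f : s i ⟶ (s j)⟦l⟧, f = 0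

/-- A `w`-simple minded system (for `w ≥ 1`): a `w`-orthogonal collection `s` such that
every object lies in `⟨s⟩ * Σ⁻¹⟨s⟩ * ⋯ * Σ⁻ʷ⁺¹⟨s⟩`. -/
structure IsSimpleMindedSystem (w : ℕ) {ι : Type*} (s : ι → C) : Prop where
  isOrthogonalCollection : IsOrthogonalCollection w s
  mem_negTower : ∀ X : C, negTower (extClosure (ObjectProperty.ofObj s)) w X

/-- A morphism `τ : x ⟶ c` is a `P`-cover: `x` lies in `P`, every morphism from an
object of `P` to `c` factors through `τ`, and `τ` is right minimal. -/
structure IsCover (P : ObjectProperty C) {x c : C} (τ : x ⟶ c) : Prop where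
  mem : P x
  factors : ∀ (y : C) (f : y ⟶ c), P y → ∃ g : y ⟶ x, g ≫ τ = f
  right_minimal : ∀ g : x ⟶ x, g ≫ τ = τ → IsIso g

/-- The extension closure `⟨S'⟩` of the subfamily `S' = (sᵢ)` with `i ∈ I`. -/
def subClosure {ι : Type*} (s : ι → C) (I : Set ι) : ObjectProperty C :=
  extClosure (ObjectProperty.ofObj (fun i : I => s i))

/-- The left tilt of the family `s` at the subfamily `S'` indexed by `I` is defined:
every `sᵢ` with `i ∉ I` has a `Σ⁻¹⟨S'⟩`-cover. -/
def LeftTiltDefined {ι : Type*} (s : ι → C) (I : Set ι) : Prop :=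
  ∀ i, i ∉ I → ∃ (x : C) (τ : x ⟶ s i), IsCover (shiftClass (subClosure s I) (-1)) τ

/-- The family `L` is a left tilt of the family `s` at the subfamily `S'` indexed by `I`.
For `i ∈ I` the object `L i` is `Σ⁻¹ sᵢ`; for `i ∉ I` it is the third term of a distinguished
triangle `x ⟶ sᵢ ⟶ L i ⟶ Σ x` in which `x ⟶ sᵢ` is a `Σ⁻¹⟨S'⟩`-cover. As covers and cones
are determined only up to isomorphism, so is `L`. -/
structure IsLeftTilt {ι : Type*} (s : ι → C) (I : Set ι) (L : ι → C) : Prop where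
  iso_of_mem : ∀ i, i ∈ I → Nonempty (L i ≅ (s i)⟦(-1 : ℤ)⟧)
  triangle_of_notMem : ∀ i, i ∉ I →
    ∃ (x : C) (τ : x ⟶ s i) (g : s i ⟶ L i) (h : L i ⟶ x⟦(1 : ℤ)⟧),
      IsCover (shiftClass (subClosure s I) (-1)) τ ∧ Triangle.mk τ g h ∈ distTriang C

/-- A proper abelian subcategory: a full subcategory closed under isomorphisms, finite direct
sums and direct summands which is abelian (for the induced addition of morphisms) and whose
short exact sequences are precisely the diagrams `a ⟶ b ⟶ c` in the subcategory that extend to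
a distinguished triangle `a ⟶ b ⟶ c ⟶ Σ a`. -/
structure IsProperAbelian (P : ObjectProperty C) : Prop where
  isClosedUnderIsomorphisms : P.IsClosedUnderIsomorphisms
  isClosedUnderFiniteProducts : P.IsClosedUnderFiniteProducts
  isStableUnderRetracts : P.IsStableUnderRetracts
  abelian : ∃ h : Abelian P.FullSubcategory,
    h.toPreadditive = (inferInstance : Preadditive P.FullSubcategory)
  shortExact_of_triangle : ∀ {a b c : P.FullSubcategory} (f : a ⟶ b) (g : b ⟶ c)
    (h : c.obj ⟶ a.obj⟦(1 : ℤ)⟧), Triangle.mk f.hom g.hom h ∈ distTriang C →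
      ∃ w : f ≫ g = 0, (ShortComplex.mk f g w).ShortExact
  triangle_of_shortExact : ∀ S : ShortComplex P.FullSubcategory, S.ShortExact →
    ∃ h : S.X₃.obj ⟶ S.X₁.obj⟦(1 : ℤ)⟧, Triangle.mk S.f.hom S.g.hom h ∈ distTriang C

end Triangulated

/-- A torsion pair `(T, F)` in a category `A` (to be used when `A` is abelian): two classes of
objects closed under isomorphisms such that all morphisms from `T` to `F` vanish and each object
`X` has a short exact sequence `0 ⟶ x ⟶ X ⟶ y ⟶ 0` with `x` in `T` and `y` in `F`. -/
structure IsTorsionPair {A : Type*} [Category* A] [HasZeroMorphisms A]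
    (T F : ObjectProperty A) : Prop where
  isClosedUnderIsomorphisms_left : T.IsClosedUnderIsomorphisms
  isClosedUnderIsomorphisms_right : F.IsClosedUnderIsomorphisms
  hom_eq_zero : ∀ {x y : A} (f : x ⟶ y), T x → F y → f = 0
  exists_shortExact : ∀ X : A, ∃ (x y : A) (i : x ⟶ X) (p : X ⟶ y) (w : i ≫ p = 0),
    T x ∧ F y ∧ (ShortComplex.mk i p w).ShortExact

/-- The classes `T` and `F` of objects of `C` are contained in the full subcategory given by `P`
and form a torsion pair in that subcategory. -/
structure IsTorsionPairIn {C : Type u} [Category.{v} C] [Preadditive C]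
    (P T F : ObjectProperty C) : Prop where
  left_le : T ≤ P
  right_le : F ≤ P
  isTorsionPair : IsTorsionPair (T.inverseImage P.ι) (F.inverseImage P.ι)

/-- The category `C` is `d`-Calabi–Yau over `k`, that is, `Σᵈ` is a Serre functor: there are
`k`-linear isomorphisms from `C(X, Y)` to the dual of `C(Y, Σᵈ X)`, natural in both variables. -/
def IsCalabiYau (k : Type*) [Field k] (C : Type u) [Category.{v} C] [Preadditive C] [Linear k C]
    [HasShift C ℤ] (d : ℤ) : Prop :=
  ∃ φ : ∀ X Y : C, (X ⟶ Y) ≃ₗ[k] Module.Dual k (Y ⟶ X⟦d⟧),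
    (∀ (X Y Z : C) (f : X ⟶ Y) (g : Y ⟶ Z) (h : Z ⟶ X⟦d⟧),
      φ X Z (f ≫ g) h = φ X Y f (g ≫ h)) ∧
    (∀ (W X Y : C) (a : W ⟶ X) (f : X ⟶ Y) (h : Y ⟶ W⟦d⟧),
      φ W Y (a ≫ f) h = φ X Y f (h ≫ a⟦d⟧'))

end SimpleMinded

/-! Since `w ≥ 2`, no object of `⟨S⟩` has a nonzero morphism to `Σ⁻¹` of another one, so in a
triangle with terms in `⟨S⟩` the first map is monic and the second epic. By Schur's lemma a nonzero
map from some `sᵢ` to an object of `⟨S⟩` has a cone in `⟨S⟩` with a shorter filtration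
(`cone_extIter`). Induction on length then factors every morphism into a deflation followed by an
inflation (`exists_fact`), which makes `⟨S⟩` proper abelian with the `sᵢ` as simple objects. Being a
Serre subcategory (`serre`), `⟨S'⟩` is a torsion class; this is (iii).

For the tilt, rotate to `sᵢ ⟶ Lᵢ ⟶ t ⟶ Σ sᵢ` with the last map a `⟨S'⟩`-cover. Wakamatsu's lemma
gives `Hom(⟨S'⟩, Σ Lᵢ) = 0`, and minimality gives `Hom(⟨S'⟩, Lᵢ) = 0`. Duality turns the latter into
`Hom(Lᵢ, Σ⁻ʷ⟨S'⟩) = 0`, the one degree out of reach of the orthogonality of `S`. This yields (i), so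
the tilt has a proper abelian closure as well. For (iv) it remains to compare `⟨L⟩` with `F * Σ⁻¹T`;
the two inclusions rest on `swap` and `torsionFree_le`.

For (ii), with `⟨S⟩ = T * F`, the product of the shifts of `⟨S⟩` is regrouped into blocks `F * Σ⁻¹T
⊆ ⟨L⟩` (`extensionProduct_le_negTower`). The ends of the product are adjusted by means of the
triangles of `exists_cotorsion` and by duality. -/

open scoped ZeroObject

set_option linter.unusedSectionVars false

namespace SimpleMinded

/-! ### Vanishing of graded Hom spaces and exactness along triangles. -/

section Vanishing

variable {C : Type u} [Category.{v} C] [Preadditive C] [HasZeroObject C] [HasShift C ℤ]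
  [∀ n : ℤ, (shiftFunctor C n).Additive]

/-- All morphisms `X ⟶ Σⁿ Y` vanish. -/
def HomZero (X Y : C) (n : ℤ) : Prop := ∀ f : X ⟶ Y⟦n⟧, f = 0

omit [HasZeroObject C] [∀ n : ℤ, (shiftFunctor C n).Additive] in
lemma homZero_zero_iff {X Y : C} : HomZero X Y 0 ↔ ∀ f : X ⟶ Y, f = 0 := by
  let e : Y⟦(0 : ℤ)⟧ ≅ Y := (shiftFunctorZero C ℤ).app Y
  constructor
  · intro h f
    simpa using congrArg (fun φ => φ ≫ e.hom) (h (f ≫ e.inv))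
  · intro h f
    simpa using congrArg (fun φ => φ ≫ e.inv) (h (f ≫ e.hom))

omit [HasZeroObject C] in
lemma HomZero.shift {X Y : C} {m : ℤ} (h : HomZero X Y m) (a b n : ℤ) (hm : m + a = b + n) :
    HomZero (X⟦a⟧) (Y⟦b⟧) n := by
  intro f
  let e : (Y⟦b⟧)⟦n⟧ ≅ (Y⟦m⟧)⟦a⟧ :=
    ((shiftFunctorAdd' C b n (b + n) rfl).app Y).symm ≪≫ (shiftFunctorAdd' C m a (b + n) hm).app Y
  rw [← cancel_mono e.hom, zero_comp, ← (shiftFunctor C a).map_preimage (f ≫ e.hom),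
    h ((shiftFunctor C a).preimage (f ≫ e.hom)), Functor.map_zero]

omit [HasZeroObject C] [∀ n : ℤ, (shiftFunctor C n).Additive] in
lemma HomZero.of_iso {X Y X' Y' : C} {n : ℤ} (h : HomZero X Y n) (e : X ≅ X') (e' : Y ≅ Y') :
    HomZero X' Y' n := by
  intro f
  have := h (e.hom ≫ f ≫ e'.inv⟦n⟧')
  rw [← cancel_mono (e'.inv⟦n⟧'), ← cancel_epi e.hom, this]
  simp

omit [HasZeroObject C] in
lemma HomZero.shift_left_iff {X Y : C} {m a n : ℤ} (hm : m + a = n) :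
    HomZero (X⟦a⟧) Y n ↔ HomZero X Y m := by
  constructor
  · intro h
    refine (h.shift (-a) 0 m (by lia)).of_iso ?_ ((shiftFunctorZero C ℤ).app Y)
    exact (shiftFunctorCompIsoId C a (-a) (by lia)).app X
  · intro h
    exact (h.shift a 0 n (by lia)).of_iso (Iso.refl _) ((shiftFunctorZero C ℤ).app Y)

omit [HasZeroObject C] in
lemma HomZero.shift_right_iff {X Y : C} {m b n : ℤ} (hm : m = b + n) :
    HomZero X (Y⟦b⟧) n ↔ HomZero X Y m := by
  constructor
  · intro h
    refine (h.shift 0 (-b) m (by lia)).of_iso ((shiftFunctorZero C ℤ).app X) ?_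
    exact (shiftFunctorCompIsoId C b (-b) (by lia)).app Y
  · intro h
    exact (h.shift 0 b n (by lia)).of_iso ((shiftFunctorZero C ℤ).app X) (Iso.refl _)

omit [HasZeroObject C] [∀ n : ℤ, (shiftFunctor C n).Additive] in
lemma HomZero.of_isZero_left {X Y : C} (n : ℤ) (h : IsZero X) : HomZero X Y n :=
  fun _ => h.eq_of_src _ _

omit [HasZeroObject C] in
lemma HomZero.of_isZero_right {X Y : C} (n : ℤ) (h : IsZero Y) : HomZero X Y n :=
  fun _ => ((shiftFunctor C n).map_isZero h).eq_of_tgt _ _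

variable [Pretriangulated C]

section

variable {X Y Z W : C} {f : X ⟶ Y} {g : Y ⟶ Z} {h : Z ⟶ X⟦(1 : ℤ)⟧}
  (hT : Triangle.mk f g h ∈ distTriang C)

include hT

lemma tri_comp₁₂ : f ≫ g = 0 := comp_distTriang_mor_zero₁₂ _ hT

lemma tri_comp₂₃ : g ≫ h = 0 := comp_distTriang_mor_zero₂₃ _ hT

lemma tri_rot : Triangle.mk g h (-f⟦(1 : ℤ)⟧') ∈ distTriang C := rot_of_distTriang _ hT

lemma tri_inv_rot : ∃ (δ : Z⟦(-1 : ℤ)⟧ ⟶ X) (δ' : Y ⟶ (Z⟦(-1 : ℤ)⟧)⟦(1 : ℤ)⟧),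
    Triangle.mk δ f δ' ∈ distTriang C :=
  ⟨_, _, inv_rot_of_distTriang _ hT⟩

lemma tri_desc₂ (φ : Y ⟶ W) (hφ : f ≫ φ = 0) : ∃ ψ : Z ⟶ W, φ = g ≫ ψ :=
  Triangle.yoneda_exact₂ _ hT φ hφ

lemma tri_desc₃ (φ : Z ⟶ W) (hφ : g ≫ φ = 0) : ∃ ψ : X⟦(1 : ℤ)⟧ ⟶ W, φ = h ≫ ψ :=
  Triangle.yoneda_exact₃ _ hT φ hφ

lemma tri_lift₂ (φ : W ⟶ Y) (hφ : φ ≫ g = 0) : ∃ ψ : W ⟶ X, φ = ψ ≫ f :=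
  Triangle.coyoneda_exact₂ _ hT φ hφ

lemma tri_lift₃ (φ : W ⟶ Z) (hφ : φ ≫ h = 0) : ∃ ψ : W ⟶ Y, φ = ψ ≫ g :=
  Triangle.coyoneda_exact₃ _ hT φ hφ

lemma tri_lift₁ (φ : W ⟶ X) (hφ : φ ≫ f = 0) :
    ∃ (ψ : W ⟶ Z⟦(-1 : ℤ)⟧) (δ : Z⟦(-1 : ℤ)⟧ ⟶ X), φ = ψ ≫ δ := by
  obtain ⟨ψ, hψ⟩ := Triangle.coyoneda_exact₂ _ (inv_rot_of_distTriang _ hT) φ hφ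
  exact ⟨ψ, _, hψ⟩

end

lemma HomZero.left₂ {X Y Z W : C} {f : X ⟶ Y} {g : Y ⟶ Z} {h : Z ⟶ X⟦(1 : ℤ)⟧}
    (hT : Triangle.mk f g h ∈ distTriang C) {n : ℤ} (h₁ : HomZero X W n) (h₃ : HomZero Z W n) :
    HomZero Y W n := by
  intro φ
  obtain ⟨ψ, hψ⟩ := tri_desc₂ hT φ (h₁ _)
  rw [hψ, h₃ ψ, comp_zero]

lemma HomZero.right₂ {X Y Z W : C} {f : X ⟶ Y} {g : Y ⟶ Z} {h : Z ⟶ X⟦(1 : ℤ)⟧}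
    (hT : Triangle.mk f g h ∈ distTriang C) {n : ℤ} (h₁ : HomZero W X n) (h₃ : HomZero W Z n) :
    HomZero W Y n := by
  intro φ
  obtain ⟨ψ, hψ⟩ : ∃ ψ : W ⟶ X⟦n⟧, φ = ψ ≫ (n.negOnePow • f⟦n⟧') :=
    Triangle.coyoneda_exact₂ _ (Triangle.shift_distinguished _ hT n) φ (h₃ _)
  rw [hψ, h₁ ψ, zero_comp]

lemma HomZero.right₁ {X Y Z W : C} {f : X ⟶ Y} {g : Y ⟶ Z} {h : Z ⟶ X⟦(1 : ℤ)⟧}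
    (hT : Triangle.mk f g h ∈ distTriang C) {n m : ℤ} (h₂ : HomZero W Y n) (h₃ : HomZero W Z m)
    (hm : n = m + 1) : HomZero W X n := by
  refine HomZero.right₂ (inv_rot_of_distTriang _ hT) ?_ h₂
  exact (HomZero.shift_right_iff (by lia)).2 h₃

/-- The first morphism of a triangle is monic with respect to objects without
morphisms to `Σ⁻¹` of the third object. -/
lemma eq_zero_of_comp_mor₁ {X Y Z W : C} {f : X ⟶ Y} {g : Y ⟶ Z} {h : Z ⟶ X⟦(1 : ℤ)⟧}
    (hT : Triangle.mk f g h ∈ distTriang C) (hW : HomZero W Z (-1)) (φ : W ⟶ X)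
    (hφ : φ ≫ f = 0) : φ = 0 := by
  obtain ⟨ψ, δ, hψ⟩ := tri_lift₁ hT φ hφ
  rw [hψ, hW ψ, zero_comp]

/-- The second morphism of a triangle is epic with respect to objects without
morphisms from `Σ` of the first object. -/
lemma eq_zero_of_mor₂_comp {X Y Z W : C} {f : X ⟶ Y} {g : Y ⟶ Z} {h : Z ⟶ X⟦(1 : ℤ)⟧}
    (hT : Triangle.mk f g h ∈ distTriang C) (hW : HomZero X W (-1)) (φ : Z ⟶ W)
    (hφ : g ≫ φ = 0) : φ = 0 := by
  obtain ⟨ψ, hψ⟩ := tri_desc₃ hT φ hφ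
  have := homZero_zero_iff.1 ((HomZero.shift_left_iff (n := 0) (a := 1) (by lia)).2 hW) ψ
  rw [hψ, this, comp_zero]

end Vanishing

/-! ### Shifts, extension products and extension closures. -/

section Closure

variable {C : Type u} [Category.{v} C] [Preadditive C] [HasZeroObject C] [HasShift C ℤ]
  [∀ n : ℤ, (shiftFunctor C n).Additive] [Pretriangulated C]

instance (P : ObjectProperty C) (n : ℤ) : (shiftClass P n).IsClosedUnderIsomorphisms := by
  unfold shiftClass; infer_instance

lemma shiftClass_iff (P : ObjectProperty C) [P.IsClosedUnderIsomorphisms] {n m : ℤ} (h : n + m = 0)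
    (X : C) : shiftClass P n X ↔ P (X⟦m⟧) := by
  constructor
  · rintro ⟨Y, hY, ⟨e⟩⟩
    exact P.prop_of_iso (((shiftFunctorCompIsoId C n m h).app Y).symm ≪≫
      (shiftFunctor C m).mapIso e) hY
  · intro hX
    exact ⟨_, hX, ⟨(shiftFunctorCompIsoId C m n (by lia)).app X⟩⟩

lemma shiftClass_shift (P : ObjectProperty C) {X : C} (hX : P X) (n : ℤ) :
    shiftClass P n (X⟦n⟧) := ⟨X, hX, ⟨Iso.refl _⟩⟩

lemma shiftClass_mono {P Q : ObjectProperty C} (h : P ≤ Q) (n : ℤ) :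
    shiftClass P n ≤ shiftClass Q n := by
  rintro X ⟨Y, hY, ⟨e⟩⟩
  exact ⟨Y, h _ hY, ⟨e⟩⟩

lemma shiftClass_shiftClass (P : ObjectProperty C) {a b c : ℤ} (h : a + b = c) :
    shiftClass (shiftClass P a) b = shiftClass P c := by
  ext X
  constructor
  · rintro ⟨Y, ⟨Z, hZ, ⟨e⟩⟩, ⟨e'⟩⟩
    exact ⟨Z, hZ, ⟨(shiftFunctorAdd' C a b c h).app Z ≪≫ (shiftFunctor C b).mapIso e ≪≫ e'⟩⟩
  · rintro ⟨Z, hZ, ⟨e⟩⟩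
    exact ⟨_, ⟨Z, hZ, ⟨Iso.refl _⟩⟩, ⟨((shiftFunctorAdd' C a b c h).app Z).symm ≪≫ e⟩⟩

lemma shiftClass_zero (P : ObjectProperty C) [P.IsClosedUnderIsomorphisms] :
    shiftClass P 0 = P := by
  ext X
  constructor
  · rintro ⟨Y, hY, ⟨e⟩⟩
    exact P.prop_of_iso (((shiftFunctorZero C ℤ).app Y).symm ≪≫ e) hY
  · intro hX
    exact ⟨X, hX, ⟨(shiftFunctorZero C ℤ).app X⟩⟩

lemma shiftClass_extensionProduct_le (P Q : ObjectProperty C) (n : ℤ) :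
    shiftClass (P.extensionProduct Q) n ≤
      (shiftClass P n).extensionProduct (shiftClass Q n) := by
  rintro X ⟨Y, ⟨A, B, f, g, h, hT, hA, hB⟩, ⟨e⟩⟩
  refine ObjectProperty.prop_of_iso _ e ?_
  exact ⟨_, _, _, _, _, Triangle.shift_distinguished _ hT n, shiftClass_shift _ hA n,
    shiftClass_shift _ hB n⟩

lemma extensionProduct_mono {P P' Q Q' : ObjectProperty C} (h : P ≤ P') (h' : Q ≤ Q') :
    P.extensionProduct Q ≤ P'.extensionProduct Q' :=
  (ObjectProperty.monotone_extensionProduct_left _ h).trans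
    (ObjectProperty.monotone_extensionProduct_right _ h')

lemma shiftClass_extensionProduct (P Q : ObjectProperty C) (n : ℤ) :
    shiftClass (P.extensionProduct Q) n =
      (shiftClass P n).extensionProduct (shiftClass Q n) := by
  refine le_antisymm (shiftClass_extensionProduct_le P Q n) ?_
  -- The reverse inclusion is the first one for shift `-n`, shifted back by `n`. Shifting by `0`
  -- only yields the isomorphism closure of `P` and `Q`, which extension products do not see.
  have := shiftClass_mono (shiftClass_extensionProduct_le (shiftClass P n) (shiftClass Q n) (-n)) n
  rw [shiftClass_shiftClass _ (c := 0) (by lia), shiftClass_zero,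
    shiftClass_shiftClass _ (c := 0) (by lia), shiftClass_shiftClass _ (c := 0) (by lia)] at this
  refine this.trans (shiftClass_mono ?_ n)
  intro X hX
  have h : ∀ R : ObjectProperty C, shiftClass R 0 ≤ R.isoClosure := by
    rintro R Y ⟨Z, hZ, ⟨e⟩⟩
    exact ⟨Z, hZ, ⟨e.symm ≪≫ (shiftFunctorZero C ℤ).app Z⟩⟩
  have := extensionProduct_mono (h P) (h Q) _ hX
  rwa [ObjectProperty.extensionProduct_isoClosure_left,
    ObjectProperty.extensionProduct_isoClosure_right] at this

instance (P : ObjectProperty C) (n : ℕ) : (extIter P n).IsClosedUnderIsomorphisms := by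
  cases n with
  | zero => exact ⟨fun e h => h.of_iso e.symm⟩
  | succ n => unfold extIter; infer_instance

instance (P : ObjectProperty C) : (extClosure P).IsClosedUnderIsomorphisms where
  of_iso := by
    rintro X Y e ⟨n, hn⟩
    exact ⟨n, ObjectProperty.prop_of_iso _ e hn⟩

instance (P : ObjectProperty C) (n : ℕ) : (negTower P n).IsClosedUnderIsomorphisms := by
  cases n with
  | zero => exact ⟨fun e h => h.of_iso e.symm⟩
  | succ n => unfold negTower; infer_instance

lemma extClosure_of_isZero (P : ObjectProperty C) {X : C} (hX : IsZero X) : extClosure P X :=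
  ⟨0, hX⟩

lemma extIter_le_succ (P : ObjectProperty C) (n : ℕ) : extIter P n ≤ extIter P (n + 1) :=
  fun X hX => ⟨X, 0, 𝟙 X, 0, 0, contractible_distinguished X, hX, Or.inr (isZero_zero C)⟩

lemma extIter_one_of_prop {P : ObjectProperty C} {X : C} (hX : P X) : extIter P 1 X :=
  ⟨0, X, 0, 𝟙 X, 0, contractible_distinguished₁ X, isZero_zero C, Or.inl hX⟩

lemma le_extClosure (P : ObjectProperty C) : P ≤ extClosure P :=
  fun _ hX => ⟨1, extIter_one_of_prop hX⟩

lemma prop_of_triangle_isZero₃ {P : ObjectProperty C} [P.IsClosedUnderIsomorphisms]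
    {X Y Z : C} {f : X ⟶ Y} {g : Y ⟶ Z} {h : Z ⟶ X⟦(1 : ℤ)⟧}
    (hT : Triangle.mk f g h ∈ distTriang C) (hZ : IsZero Z) : P X ↔ P Y := by
  have : IsIso f := (Triangle.isZero₃_iff_isIso₁ _ hT).1 hZ
  exact P.prop_iff_of_iso (asIso f)

lemma prop_of_triangle_isZero₁ {P : ObjectProperty C} [P.IsClosedUnderIsomorphisms]
    {X Y Z : C} {f : X ⟶ Y} {g : Y ⟶ Z} {h : Z ⟶ X⟦(1 : ℤ)⟧}
    (hT : Triangle.mk f g h ∈ distTriang C) (hX : IsZero X) : P Y ↔ P Z := by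
  have : IsIso g := (Triangle.isZero₁_iff_isIso₂ _ hT).1 hX
  exact P.prop_iff_of_iso (asIso g)

section

variable {P Q : ObjectProperty C}

/-- To show that an extension closure is contained in `Q` it suffices that `Q` contains the
zero objects and is closed under extensions by the generators. -/
lemma extClosure_le (h₀ : ∀ X, IsZero X → Q X) (hPQ : P ≤ Q)
    (hQ : Q.extensionProduct Q ≤ Q) : extClosure P ≤ Q := by
  rintro X ⟨n, hn⟩
  induction n generalizing X with
  | zero => exact h₀ _ hn
  | succ n ih =>
    obtain ⟨A, B, f, g, h, hT, hA, hB⟩ := hn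
    exact hQ _ ⟨A, B, f, g, h, hT, ih _ hA, hB.elim (hPQ _) (h₀ _)⟩

lemma HomZero.extClosure_left {n : ℤ} {Y : C} (h : ∀ X, P X → HomZero X Y n) :
    ∀ X, extClosure P X → HomZero X Y n :=
  extClosure_le (Q := fun X => HomZero X Y n) (fun _ hX => .of_isZero_left _ hX) h
    (fun _ ⟨_, _, _, _, _, hT, hA, hB⟩ => HomZero.left₂ hT hA hB)

lemma HomZero.extClosure_right {n : ℤ} {X : C} (h : ∀ Y, P Y → HomZero X Y n) :
    ∀ Y, extClosure P Y → HomZero X Y n :=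
  extClosure_le (Q := fun Y => HomZero X Y n) (fun _ hX => .of_isZero_right _ hX) h
    (fun _ ⟨_, _, _, _, _, hT, hA, hB⟩ => HomZero.right₂ hT hA hB)

variable [IsTriangulated C]

lemma extIter_add (m n : ℕ) : (extIter P m).extensionProduct (extIter P n) ≤ extIter P (m + n) := by
  induction n with
  | zero =>
    rintro X ⟨A, B, f, g, h, hT, hA, hB⟩
    exact (prop_of_triangle_isZero₃ hT hB).1 hA
  | succ n ih =>
    change (extIter P m).extensionProduct ((extIter P n).extensionProduct _) ≤ _
    rw [← ObjectProperty.extensionProduct_assoc]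
    exact ObjectProperty.monotone_extensionProduct_left _ ih

lemma extClosure_ext : (extClosure P).extensionProduct (extClosure P) ≤ extClosure P := by
  rintro X ⟨A, B, f, g, h, hT, ⟨m, hA⟩, ⟨n, hB⟩⟩
  exact ⟨m + n, extIter_add m n _ ⟨A, B, f, g, h, hT, hA, hB⟩⟩

/-- The definition splits a generator off as the last quotient; associativity of `*` splits one off
as the first subobject instead, the form needed by the inductions on length below. -/
lemma extIter_succ_le (n : ℕ) : extIter P (n + 1) ≤
    ObjectProperty.extensionProduct (fun X => P X ∨ IsZero X) (extIter P n) := by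
  induction n with
  | zero =>
    rintro X ⟨A, B, f, g, h, hT, hA, hB⟩
    refine (prop_of_triangle_isZero₁ (P := ObjectProperty.extensionProduct _ _) hT hA).2 ?_
    exact ⟨B, 0, 𝟙 B, 0, 0, contractible_distinguished B, hB, isZero_zero C⟩
  | succ n ih =>
    change (extIter P (n + 1)).extensionProduct _ ≤ _
    refine (ObjectProperty.monotone_extensionProduct_left _ ih).trans ?_
    rw [ObjectProperty.extensionProduct_assoc]
    rfl

end

lemma extClosure_mono {P Q : ObjectProperty C} [IsTriangulated C] (h : P ≤ (extClosure Q)) :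
    extClosure P ≤ extClosure Q :=
  extClosure_le (fun _ => extClosure_of_isZero Q) h extClosure_ext

lemma shiftClass_extClosure_le [IsTriangulated C] {P Q : ObjectProperty C} (n : ℤ)
    (h : shiftClass P n ≤ extClosure Q) :
    shiftClass (extClosure P) n ≤ extClosure Q := by
  rintro X ⟨Y, hY, ⟨e⟩⟩
  refine ObjectProperty.prop_of_iso _ e ?_
  refine extClosure_le (Q := fun Y => extClosure Q (Y⟦n⟧)) ?_ ?_ ?_ Y hY
  · intro X hX
    exact extClosure_of_isZero _ ((shiftFunctor C n).map_isZero hX)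
  · intro X hX
    exact h _ (shiftClass_shift P hX n)
  · rintro X ⟨A, B, f, g, h, hT, hA, hB⟩
    exact extClosure_ext _ ⟨_, _, _, _, _, Triangle.shift_distinguished _ hT n, hA, hB⟩

end Closure

/-! ### Admissible classes are proper abelian subcategories. -/

section Admissible

variable {C : Type u} [Category.{v} C] [Preadditive C] [HasZeroObject C] [HasShift C ℤ]
  [∀ n : ℤ, (shiftFunctor C n).Additive] [Pretriangulated C] [IsTriangulated C]

/-- Morphisms whose cone lies in `A`. -/
def Infl (A : ObjectProperty C) {X Y : C} (f : X ⟶ Y) : Prop :=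
  ∃ (Z : C) (g : Y ⟶ Z) (h : Z ⟶ X⟦(1 : ℤ)⟧), A Z ∧ Triangle.mk f g h ∈ distTriang C

/-- Morphisms whose cocone lies in `A`. -/
def Defl (A : ObjectProperty C) {Y Z : C} (g : Y ⟶ Z) : Prop :=
  ∃ (X : C) (f : X ⟶ Y) (h : Z ⟶ X⟦(1 : ℤ)⟧), A X ∧ Triangle.mk f g h ∈ distTriang C

/-- Extension closed classes without morphisms to their negative shift in which every
morphism is a deflation followed by an inflation. -/
structure IsAdmissible (A : ObjectProperty C) : Prop where
  of_iso : A.IsClosedUnderIsomorphisms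
  of_isZero : ∀ X, IsZero X → A X
  ext : A.extensionProduct A ≤ A
  neg : ∀ X Y, A X → A Y → HomZero X Y (-1)
  fact : ∀ (X Y : C) (f : X ⟶ Y), A X → A Y →
    ∃ (J : C) (p : X ⟶ J) (i : J ⟶ Y), A J ∧ Defl A p ∧ Infl A i ∧ p ≫ i = f

lemma tri_cone_iso {X Y Z Z' : C} {f : X ⟶ Y} {g : Y ⟶ Z} {h : Z ⟶ X⟦(1 : ℤ)⟧}
    {g' : Y ⟶ Z'} {h' : Z' ⟶ X⟦(1 : ℤ)⟧}
    (hT : Triangle.mk f g h ∈ distTriang C) (hT' : Triangle.mk f g' h' ∈ distTriang C) :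
    Nonempty (Z ≅ Z') :=
  ⟨Triangle.π₃.mapIso (isoTriangleOfIso₁₂ _ _ hT hT' (Iso.refl _) (Iso.refl _)
    ((Category.comp_id f).trans (Category.id_comp f).symm))⟩

lemma defl_of_cone {A : ObjectProperty C} {X Y Z : C} {f : X ⟶ Y} {g : Y ⟶ Z}
    {h : Z ⟶ X⟦(1 : ℤ)⟧} (hT : Triangle.mk f g h ∈ distTriang C) (hZ : A (Z⟦(-1 : ℤ)⟧)) :
    Defl A f :=
  ⟨_, _, _, hZ, inv_rot_of_distTriang _ hT⟩

lemma Defl.cone {A : ObjectProperty C} [A.IsClosedUnderIsomorphisms]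
    {X Y Z : C} {f : X ⟶ Y} (hf : Defl A f) {g : Y ⟶ Z}
    {h : Z ⟶ X⟦(1 : ℤ)⟧} (hT : Triangle.mk f g h ∈ distTriang C) : A (Z⟦(-1 : ℤ)⟧) := by
  obtain ⟨W, k, l, hW, hT'⟩ := hf
  obtain ⟨e⟩ := tri_cone_iso (tri_rot hT') hT
  exact A.prop_of_iso (((shiftFunctorCompIsoId C (1 : ℤ) (-1) (by lia)).app W).symm ≪≫
    (shiftFunctor C (-1 : ℤ)).mapIso e) hW

lemma Infl.comp {A : ObjectProperty C} (hA : A.extensionProduct A ≤ A)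
    {X Y Z : C} {f : X ⟶ Y} {g : Y ⟶ Z} (hf : Infl A f) (hg : Infl A g) : Infl A (f ≫ g) := by
  obtain ⟨U, f', f'', hU, hT⟩ := hf
  obtain ⟨V, g', g'', hV, hT'⟩ := hg
  obtain ⟨W, k, l, hT''⟩ := distinguished_cocone_triangle (f ≫ g)
  have o := Triangulated.someOctahedron rfl hT hT' hT''
  exact ⟨W, k, l, hA _ ⟨_, _, _, _, _, o.mem, hU, hV⟩, hT''⟩

lemma Defl.comp {A : ObjectProperty C} (hA : A.extensionProduct A ≤ A)
    {X Y Z : C} {f : X ⟶ Y} {g : Y ⟶ Z} (hf : Defl A f) (hg : Defl A g) : Defl A (f ≫ g) := by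
  obtain ⟨U, f', f'', hU, hT⟩ := hf
  obtain ⟨V, g', g'', hV, hT'⟩ := hg
  obtain ⟨W, k, l, hT''⟩ := distinguished_cocone_triangle₁ (f ≫ g)
  have o := Triangulated.someOctahedron' rfl hT hT' hT''
  exact ⟨W, k, l, hA _ ⟨_, _, _, _, _, o.mem, hU, hV⟩, hT''⟩

lemma infl_of_isIso {A : ObjectProperty C} (hA : ∀ X, IsZero X → A X) {X Y : C} (f : X ⟶ Y)
    [IsIso f] : Infl A f :=
  ⟨0, 0, 0, hA _ (isZero_zero C),
    (Triangle.distinguished_iff_of_isZero₃ (Triangle.mk f 0 0) (isZero_zero C)).2 ‹_›⟩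

lemma defl_of_isIso {A : ObjectProperty C} (hA : ∀ X, IsZero X → A X) {X Y : C} (f : X ⟶ Y)
    [IsIso f] : Defl A f :=
  ⟨0, 0, 0, hA _ (isZero_zero C),
    (Triangle.distinguished_iff_of_isZero₁ (Triangle.mk 0 f 0) (isZero_zero C)).2 ‹_›⟩

namespace IsAdmissible

variable {A : ObjectProperty C} (hA : IsAdmissible A)

include hA

lemma cancel_infl {W X Y : C} {i : X ⟶ Y} (hi : Infl A i) (hW : A W) {φ ψ : W ⟶ X}
    (h : φ ≫ i = ψ ≫ i) : φ = ψ := by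
  obtain ⟨Z, g, l, hZ, hT⟩ := hi
  rw [← sub_eq_zero]
  exact eq_zero_of_comp_mor₁ hT (hA.neg _ _ hW hZ) _ (by rw [Preadditive.sub_comp, h, sub_self])

lemma cancel_defl {X Y W : C} {p : X ⟶ Y} (hp : Defl A p) (hW : A W) {φ ψ : Y ⟶ W}
    (h : p ≫ φ = p ≫ ψ) : φ = ψ := by
  obtain ⟨Z, g, l, hZ, hT⟩ := hp
  rw [← sub_eq_zero]
  exact eq_zero_of_mor₂_comp hT (hA.neg _ _ hZ hW) _ (by rw [Preadditive.comp_sub, h, sub_self])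

/-- The idempotent `r.r ≫ r.i` factors inside `A` as a deflation `p` followed by an inflation `m`.
Cancelling both gives `m ≫ p = 𝟙 J`, so `J` splits the same idempotent as `X` and is isomorphic to
it. -/
lemma retract : A.IsStableUnderRetracts where
  of_retract {X Y} r hY := by
    have := hA.of_iso
    obtain ⟨J, p, m, hJ, hp, hm, h⟩ := hA.fact _ _ (r.r ≫ r.i) hY hY
    have hmp : m ≫ p = 𝟙 J := by
      refine hA.cancel_infl hm hJ (hA.cancel_defl hp hY ?_)
      rw [Category.assoc, reassoc_of% h, h]
      simp [h]
    refine A.prop_of_iso (X := J) ⟨m ≫ r.r, r.i ≫ p, ?_, ?_⟩ hJ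
    · rw [Category.assoc, ← reassoc_of% h, hmp, reassoc_of% hmp]
    · rw [Category.assoc, reassoc_of% h]
      simp

lemma isClosedUnderBinaryProducts : A.IsClosedUnderBinaryProducts where
  limitsOfShape_le := by
    have := hA.of_iso
    rintro X ⟨p⟩
    let Y₁ := p.diag.obj ⟨WalkingPair.left⟩
    let Y₂ := p.diag.obj ⟨WalkingPair.right⟩
    have h : A (Y₁ ⊞ Y₂) :=
      hA.ext _ ⟨_, _, _, _, _, binaryBiproductTriangle_distinguished Y₁ Y₂, p.prop_diag_obj _,
        p.prop_diag_obj _⟩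
    let e : pair Y₁ Y₂ ≅ p.diag := (diagramIsoPair p.diag).symm
    exact A.prop_of_iso ((BinaryBiproduct.isLimit Y₁ Y₂).conePointsIsoOfNatIso p.isLimit e) h

lemma isClosedUnderFiniteProducts : A.IsClosedUnderFiniteProducts := by
  have := hA.of_iso
  have : A.ContainsZero := ⟨0, isZero_zero C, hA.of_isZero _ (isZero_zero C)⟩
  have := hA.isClosedUnderBinaryProducts
  exact .mk'

section

variable {X Y Z : A.FullSubcategory} {f : X ⟶ Y} {g : Y ⟶ Z} {h : Z.obj ⟶ X.obj⟦(1 : ℤ)⟧}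
  (hT : Triangle.mk f.hom g.hom h ∈ distTriang C)

include hT

lemma sub_comp : f ≫ g = 0 := by
  ext
  exact tri_comp₁₂ hT

lemma sub_mono : Mono f := by
  rw [Preadditive.mono_iff_cancel_zero]
  intro W φ hφ
  ext
  exact eq_zero_of_comp_mor₁ hT (hA.neg _ _ W.2 Z.2) _ (congrArg (·.hom) hφ)

lemma sub_epi : Epi g := by
  rw [Preadditive.epi_iff_cancel_zero]
  intro W φ hφ
  ext
  exact eq_zero_of_mor₂_comp hT (hA.neg _ _ X.2 W.2) _ (congrArg (·.hom) hφ)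

lemma sub_lift {W : A.FullSubcategory} (φ : W ⟶ Y) (hφ : φ ≫ g = 0) :
    ∃ ψ : W ⟶ X, ψ ≫ f = φ := by
  obtain ⟨ψ, hψ⟩ := tri_lift₂ hT φ.hom (congrArg (·.hom) hφ)
  exact ⟨ObjectProperty.homMk ψ, by ext; exact hψ.symm⟩

lemma sub_desc {W : A.FullSubcategory} (φ : Y ⟶ W) (hφ : f ≫ φ = 0) :
    ∃ ψ : Z ⟶ W, g ≫ ψ = φ := by
  obtain ⟨ψ, hψ⟩ := tri_desc₂ hT φ.hom (congrArg (·.hom) hφ)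
  exact ⟨ObjectProperty.homMk ψ, by ext; exact hψ.symm⟩

/-- The first morphism of a triangle in `A` is a kernel of the second one. -/
noncomputable def subIsKernel : IsLimit (KernelFork.ofι f (hA.sub_comp hT)) :=
  have := hA.sub_mono hT
  KernelFork.IsLimit.ofι _ _ (fun φ hφ => (hA.sub_lift hT φ hφ).choose)
    (fun φ hφ => (hA.sub_lift hT φ hφ).choose_spec)
    (fun φ hφ m hm => by rw [← cancel_mono f, hm, (hA.sub_lift hT φ hφ).choose_spec])

/-- The second morphism of a triangle in `A` is a cokernel of the first one. -/
noncomputable def subIsCokernel : IsColimit (CokernelCofork.ofπ g (hA.sub_comp hT)) :=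
  have := hA.sub_epi hT
  CokernelCofork.IsColimit.ofπ _ _ (fun φ hφ => (hA.sub_desc hT φ hφ).choose)
    (fun φ hφ => (hA.sub_desc hT φ hφ).choose_spec)
    (fun φ hφ m hm => by rw [← cancel_epi g, hm, (hA.sub_desc hT φ hφ).choose_spec])

end

/-- For `f = p ≫ i`, the cocone of the deflation `p` is the kernel of `f`, the cone of the inflation
`i` is its cokernel, and `J` is both image and coimage. -/
lemma exists_abelianStruct {X Y : A.FullSubcategory} (f : X ⟶ Y) :
    Nonempty (Abelian.AbelianStruct f) := by
  obtain ⟨J, p, i, hJ, ⟨K, k, k', hK, hTp⟩, ⟨Q, q, q', hQ, hTi⟩, hpi⟩ :=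
    hA.fact _ _ f.hom X.2 Y.2
  let J' : A.FullSubcategory := ⟨J, hJ⟩
  let K' : A.FullSubcategory := ⟨K, hK⟩
  let Q' : A.FullSubcategory := ⟨Q, hQ⟩
  let p' : X ⟶ J' := ObjectProperty.homMk p
  let i' : J' ⟶ Y := ObjectProperty.homMk i
  let φ : K' ⟶ X := ObjectProperty.homMk k
  let q₁ : Y ⟶ Q' := ObjectProperty.homMk q
  have fac : p' ≫ i' = f := by ext; exact hpi
  have hTp' : Triangle.mk φ.hom p'.hom k' ∈ distTriang C := hTp
  have hTi' : Triangle.mk i'.hom q₁.hom q' ∈ distTriang C := hTi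
  have := hA.sub_mono hTi'
  have := hA.sub_epi hTp'
  have w₁ := hA.sub_comp hTp'
  have w₂ := hA.sub_comp hTi'
  exact ⟨{
    kernelFork := KernelFork.ofι φ (show φ ≫ f = 0 by rw [← fac, reassoc_of% w₁, zero_comp])
    isLimitKernelFork := isKernelCompMono (hA.subIsKernel hTp') i' fac.symm
    cokernelCofork := CokernelCofork.ofπ q₁ (show f ≫ q₁ = 0 by
      rw [← fac, Category.assoc, w₂, comp_zero])
    isColimitCokernelCofork := isCokernelEpiComp (hA.subIsCokernel hTi') p' fac.symm
    image := J'
    imageι := i'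
    imageπ := p'
    ι_imageπ := w₁
    imageι_π := w₂
    imageIsCokernel := hA.subIsCokernel hTp'
    imageIsKernel := hA.subIsKernel hTi'
    fac := fac }⟩

/-- The abelian category structure on an admissible class. -/
@[reducible]
noncomputable def abelian : Abelian A.FullSubcategory :=
  have := hA.isClosedUnderFiniteProducts
  Abelian.mk' (fun _ _ f => hA.exists_abelianStruct f)

/-- The cone of the inflation part of `f` is a cokernel of `f`; it vanishes for an epimorphism, so
this part is invertible. -/
lemma defl_of_epi {X Y : A.FullSubcategory} (f : X ⟶ Y) [Epi f] : Defl A f.hom := by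
  have := hA.of_iso
  obtain ⟨J, p, i, hJ, hp, ⟨Q, q, q', hQ, hT⟩, hpi⟩ := hA.fact _ _ f.hom X.2 Y.2
  have hq : q = 0 := by
    have : f ≫ (ObjectProperty.homMk q : Y ⟶ ⟨Q, hQ⟩) = 0 := by
      ext
      change f.hom ≫ q = 0
      rw [← hpi, Category.assoc, tri_comp₁₂ hT, comp_zero]
    exact congrArg (·.hom) (Preadditive.epi_iff_cancel_zero f |>.1 ‹_› _ _ this)
  have hQ₀ : IsZero Q := by
    rw [IsZero.iff_id_eq_zero]
    exact eq_zero_of_mor₂_comp hT (hA.neg _ _ hJ hQ) _ (by rw [hq, zero_comp])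
  have : IsIso i := (Triangle.isZero₃_iff_isIso₁ _ hT).1 hQ₀
  rw [← hpi]
  exact hp.comp hA.ext (defl_of_isIso hA.of_isZero i)

lemma infl_of_mono {X Y : A.FullSubcategory} (f : X ⟶ Y) [Mono f] : Infl A f.hom := by
  have := hA.of_iso
  obtain ⟨J, p, i, hJ, ⟨K, k, k', hK, hT⟩, hi, hpi⟩ := hA.fact _ _ f.hom X.2 Y.2
  have hk : k = 0 := by
    have : (ObjectProperty.homMk k : (⟨K, hK⟩ : A.FullSubcategory) ⟶ X) ≫ f = 0 := by
      ext
      change k ≫ f.hom = 0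
      rw [← hpi, reassoc_of% (tri_comp₁₂ hT), zero_comp]
    exact congrArg (·.hom) (Preadditive.mono_iff_cancel_zero f |>.1 ‹_› _ _ this)
  have hK₀ : IsZero K := by
    rw [IsZero.iff_id_eq_zero]
    exact eq_zero_of_comp_mor₁ hT (hA.neg _ _ hK hJ) _ (by rw [hk, comp_zero])
  have : IsIso p := (Triangle.isZero₁_iff_isIso₂ _ hT).1 hK₀
  rw [← hpi]
  exact (infl_of_isIso hA.of_isZero p).comp hA.ext hi

lemma isProperAbelian : IsProperAbelian A where
  isClosedUnderIsomorphisms := hA.of_iso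
  isClosedUnderFiniteProducts := hA.isClosedUnderFiniteProducts
  isStableUnderRetracts := hA.retract
  abelian := ⟨hA.abelian, rfl⟩
  shortExact_of_triangle {a b c} f g h hT := by
    let := hA.abelian
    refine ⟨hA.sub_comp hT, ?_⟩
    have := hA.sub_mono hT
    have := hA.sub_epi hT
    exact ⟨ShortComplex.exact_of_f_is_kernel _ (hA.subIsKernel hT)⟩
  triangle_of_shortExact S hS := by
    let := hA.abelian
    have := hS.epi_g
    have := hS.mono_f
    -- The cocone of `S.g` is a kernel, hence isomorphic to `S.X₁`; the triangle is transported
    -- along this isomorphism.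
    obtain ⟨K, k, h, hK, hT⟩ := hA.defl_of_epi S.g
    let K' : A.FullSubcategory := ⟨K, hK⟩
    let k' : K' ⟶ S.X₂ := ObjectProperty.homMk k
    have hT' : Triangle.mk k'.hom S.g.hom h ∈ distTriang C := hT
    let e : S.X₁ ≅ K' := IsLimit.conePointUniqueUpToIso hS.exact.fIsKernel (hA.subIsKernel hT')
    have he : e.hom ≫ k' = S.f :=
      IsLimit.conePointUniqueUpToIso_hom_comp hS.exact.fIsKernel (hA.subIsKernel hT')
        WalkingParallelPair.zero
    refine ⟨h ≫ e.inv.hom⟦1⟧', isomorphic_distinguished _ hT' _ ?_⟩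
    refine Triangle.isoMk _ _ ((ObjectProperty.ι A).mapIso e) (Iso.refl _) (Iso.refl _) ?_ ?_ ?_
    · exact (Category.comp_id _).trans (congrArg (·.hom) he).symm
    · exact (Category.comp_id _).trans (Category.id_comp _).symm
    · change (h ≫ e.inv.hom⟦1⟧') ≫ e.hom.hom⟦1⟧' = 𝟙 _ ≫ h
      rw [Category.assoc, ← Functor.map_comp, ObjectProperty.isoInv_hom_id_hom]
      exact (congrArg (h ≫ ·) (CategoryTheory.Functor.map_id _ _)).trans
        ((Category.comp_id h).trans (Category.id_comp h).symm)

end IsAdmissible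

end Admissible

/-! ### Extension closures of semibricks: length, factorizations, torsion. -/

section Bricks

variable {C : Type u} [Category.{v} C] [Preadditive C] [HasZeroObject C] [HasShift C ℤ]
  [∀ n : ℤ, (shiftFunctor C n).Additive] [Pretriangulated C] [IsTriangulated C]

/-- Families of orthogonal objects with skew fields as endomorphism rings and without morphisms
to their negative shifts. -/
structure IsSemibrick {ι : Type*} (s : ι → C) : Prop where
  id_ne_zero : ∀ i, 𝟙 (s i) ≠ 0
  isIso : ∀ i (f : s i ⟶ s i), f ≠ 0 → IsIso f
  hom_eq_zero : ∀ i j, i ≠ j → ∀ f : s i ⟶ s j, f = 0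
  neg : ∀ i j, HomZero (s i) (s j) (-1)

namespace IsSemibrick

variable {ι : Type*} {s : ι → C} (hs : IsSemibrick s)

include hs

lemma isIso_of_ne_zero {i j : ι} {f : s i ⟶ s j} (hf : f ≠ 0) : IsIso f := by
  obtain rfl : i = j := by
    by_contra h
    exact hf (hs.hom_eq_zero i j h f)
  exact hs.isIso i f hf

lemma restrict (I : Set ι) : IsSemibrick (fun i : I => s i) where
  id_ne_zero i := hs.id_ne_zero i
  isIso i := hs.isIso i
  hom_eq_zero i j h := hs.hom_eq_zero i j (fun h' => h (Subtype.ext h'))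
  neg i j := hs.neg i j

lemma closure_neg (X Y : C) (hX : extClosure (.ofObj s) X) (hY : extClosure (.ofObj s) Y) :
    HomZero X Y (-1) :=
  HomZero.extClosure_left (fun _ ⟨i⟩ => HomZero.extClosure_right (fun _ ⟨j⟩ => hs.neg i j) Y hY)
    X hX

/-- A nonzero morphism from a member of the family to an object of length `n` has a
cone of length `n - 1`. -/
lemma cone_extIter {n : ℕ} {i : ι} {Y Z : C} {f : s i ⟶ Y} (hY : extIter (.ofObj s) n Y)
    (hf : f ≠ 0) {g : Y ⟶ Z} {h : Z ⟶ (s i)⟦(1 : ℤ)⟧} (hT : Triangle.mk f g h ∈ distTriang C) :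
    ∃ m, n = m + 1 ∧ extIter (.ofObj s) m Z := by
  induction n generalizing Y Z with
  | zero => exact (hf (IsZero.eq_of_tgt hY _ _)).elim
  | succ n ih =>
    refine ⟨n, rfl, ?_⟩
    obtain ⟨Y', S', a, b, c, hT', hY', hS'⟩ := hY
    -- If `f` dies in the top factor `S'`, it comes from `Y'`, and the cone of `f` is an extension
    -- of `S'` by the cone of the lift.
    by_cases hb : f ≫ b = 0
    · obtain ⟨f', rfl⟩ := tri_lift₂ hT' f hb
      obtain ⟨Z', g', h', hT''⟩ := distinguished_cocone_triangle f'
      obtain ⟨m, rfl, hm⟩ := ih (f := f') hY' (fun h0 => hf (by rw [h0, zero_comp])) hT''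
      have o := Triangulated.someOctahedron rfl hT'' hT' hT
      exact ⟨_, _, _, _, _, o.mem, hm, hS'⟩
    -- Otherwise `f ≫ b` is invertible by Schur's lemma, and the octahedron identifies the cone of
    -- `f` with `Y'`.
    · have hS'' : ∃ j, Nonempty (s j ≅ S') := by
        obtain ⟨⟨j⟩⟩ | hS₀ := hS'
        · exact ⟨j, ⟨Iso.refl _⟩⟩
        · exact (hb (hS₀.eq_of_tgt _ _)).elim
      obtain ⟨j, ⟨e⟩⟩ := hS''
      have : IsIso ((f ≫ b) ≫ e.inv) := hs.isIso_of_ne_zero (fun h0 => hb (by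
        rw [← cancel_mono e.inv, h0, zero_comp]))
      have : IsIso (f ≫ b) := IsIso.of_isIso_comp_right _ e.inv
      have hT₀ : Triangle.mk (f ≫ b) (0 : S' ⟶ 0) 0 ∈ distTriang C :=
        (Triangle.distinguished_iff_of_isZero₃ (Triangle.mk (f ≫ b) 0 0) (isZero_zero C)).2 ‹_›
      have o := Triangulated.someOctahedron rfl hT (tri_rot hT') hT₀
      have : IsIso ((-a⟦(1 : ℤ)⟧') ≫ g⟦(1 : ℤ)⟧') :=
        (Triangle.isZero₂_iff_isIso₃ _ o.mem).1 (isZero_zero C)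
      exact ObjectProperty.prop_of_iso _ ((shiftFunctor C (1 : ℤ)).preimageIso
        (asIso ((-a⟦(1 : ℤ)⟧') ≫ g⟦(1 : ℤ)⟧'))) hY'

lemma infl_of_ne_zero {i : ι} {Y : C} {f : s i ⟶ Y} (hY : extClosure (.ofObj s) Y)
    (hf : f ≠ 0) : Infl (extClosure (.ofObj s)) f := by
  obtain ⟨n, hY⟩ := hY
  obtain ⟨Z, g, h, hT⟩ := distinguished_cocone_triangle f
  obtain ⟨m, -, hm⟩ := hs.cone_extIter hY hf hT
  exact ⟨Z, g, h, ⟨m, hm⟩, hT⟩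

lemma closure_mem (i : ι) : extClosure (.ofObj s) (s i) := le_extClosure _ _ ⟨i⟩

/-- Induction on the length of `X`, with bottom factor `S'`. If `f` kills `S'`, it descends to `X'`.
Otherwise `S'` embeds in `Y` as well; dividing both sides by it gives `f' : X' ⟶ Y'`, and the image
of `f` is the preimage in `Y` of the image of `f'`. -/
lemma exists_fact {n : ℕ} {X Y : C} (f : X ⟶ Y) (hX : extIter (.ofObj s) n X)
    (hY : extClosure (.ofObj s) Y) :
    ∃ (J : C) (p : X ⟶ J) (i : J ⟶ Y), extClosure (.ofObj s) J ∧ Defl (extClosure (.ofObj s)) p ∧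
      Infl (extClosure (.ofObj s)) i ∧ p ≫ i = f := by
  have hz : ∀ X : C, IsZero X → extClosure (.ofObj s) X := fun _ => extClosure_of_isZero _
  have hext : ObjectProperty.extensionProduct (extClosure (.ofObj s)) (extClosure (.ofObj s)) ≤
    extClosure (.ofObj s) := extClosure_ext
  have key : ∀ {W X Y : C} {i : X ⟶ Y}, Infl (extClosure (.ofObj s)) i →
      extClosure (.ofObj s) W → ∀ φ : W ⟶ X, φ ≫ i = 0 → φ = 0 := by
    rintro W X Y i ⟨Z, g, h, hZ, hT⟩ hW φ hφ
    exact eq_zero_of_comp_mor₁ hT (hs.closure_neg _ _ hW hZ) φ hφ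
  induction n generalizing X Y with
  | zero =>
    refine ⟨X, 𝟙 X, f, hz _ hX, defl_of_isIso hz _, ⟨Y, 𝟙 Y, 0, hY, ?_⟩, Category.id_comp _⟩
    obtain rfl : f = 0 := IsZero.eq_of_src hX _ _
    exact (Triangle.distinguished_iff_of_isZero₁ (Triangle.mk 0 (𝟙 Y) 0) hX).2
      (inferInstanceAs (IsIso (𝟙 Y)))
  | succ n ih =>
    have hX₀ := hX
    obtain ⟨S', X', a, b, c, hT, hS', hX'⟩ := extIter_succ_le n _ hX
    by_cases haf : a ≫ f = 0
    · obtain ⟨f', rfl⟩ := tri_desc₂ hT f haf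
      obtain ⟨J, p, i, hJ, hp, hi, rfl⟩ := ih f' hX' hY
      exact ⟨J, b ≫ p, i, hJ, Defl.comp hext ⟨_, _, _, hS'.elim (le_extClosure _ _) (hz _), hT⟩ hp,
        hi, Category.assoc _ _ _⟩
    · have hS'' : ObjectProperty.ofObj s S' := hS'.resolve_right (fun h0 => haf (h0.eq_of_src _ _))
      obtain ⟨k⟩ := hS''
      obtain ⟨Y', q, r, hY', hTY⟩ := hs.infl_of_ne_zero hY haf
      obtain ⟨f', hf₁, hf₂⟩ : ∃ f' : X' ⟶ Y', b ≫ f' = f ≫ q ∧ c ≫ (𝟙 _)⟦1⟧' = f' ≫ r :=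
        complete_distinguished_triangle_morphism _ _ hT hTY (𝟙 _) f (Category.id_comp _).symm
      obtain ⟨J', p', i', hJ', hp', hi', hpi'⟩ := ih f' hX' hY'
      obtain ⟨Q, d, e, hQ, hTQ⟩ := hi'
      obtain ⟨J, i, l, hTJ⟩ := distinguished_cocone_triangle₁ (q ≫ d)
      have o := Triangulated.someOctahedron' rfl hTY hTQ hTJ
      have hJ : extClosure (.ofObj s) J := hext _ ⟨_, _, _, _, _, o.mem, hs.closure_mem k, hJ'⟩
      have hi : Infl (extClosure (.ofObj s)) i := ⟨Q, _, _, hQ, hTJ⟩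
      obtain ⟨p, hp⟩ := tri_lift₂ hTJ f (by
        rw [← reassoc_of% hf₁, ← hpi', Category.assoc, tri_comp₁₂ hTQ, comp_zero, comp_zero])
      have hap : a ≫ p = o.m₁ := by
        rw [← sub_eq_zero]
        refine key hi (hs.closure_mem k) _ ?_
        rw [Preadditive.sub_comp, o.comm₁, Category.assoc, ← hp, sub_self]
      have hpm : p ≫ o.m₃ = b ≫ p' := by
        rw [← sub_eq_zero]
        refine key ⟨Q, d, e, hQ, hTQ⟩ ⟨_, hX₀⟩ _ ?_
        rw [Preadditive.sub_comp, Category.assoc, o.comm₄, Category.assoc, hpi', hf₁,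
          reassoc_of% hp, sub_self]
      obtain ⟨Z, u, v, hTp⟩ := distinguished_cocone_triangle p
      -- `X` and `J` contain the same copy of `s k`, so `p` and `p'` have the same cone.
      have o' := Triangulated.someOctahedron hap hT hTp o.mem
      have hm₁ : o'.m₁ = p' := by
        rw [← sub_eq_zero]
        refine eq_zero_of_mor₂_comp hT (hs.closure_neg _ _ (hs.closure_mem k) hJ') _ ?_
        rw [Preadditive.comp_sub, o'.comm₁, hpm, sub_self]
      exact ⟨J, p, i, hJ, defl_of_cone hTp ((hm₁ ▸ hp').cone o'.mem), hi, hp.symm⟩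

lemma isAdmissible : IsAdmissible (extClosure (.ofObj s)) where
  of_iso := inferInstance
  of_isZero _ := extClosure_of_isZero _
  ext := extClosure_ext
  neg := hs.closure_neg
  fact _ _ f := fun ⟨_, hX⟩ hY => hs.exists_fact f hX hY

/-! ### Subfamilies: Serre property, torsion and cotorsion triangles. -/

section Sub

variable (I : Set ι)

omit hs in
lemma _root_.SimpleMinded.subClosure_le : subClosure s I ≤ extClosure (.ofObj s) :=
  extClosure_mono (fun _ ⟨i⟩ => le_extClosure _ _ ⟨(i : ι)⟩)

omit hs in
variable {I} in
lemma _root_.SimpleMinded.subClosure_mem {i : ι} (hi : i ∈ I) : subClosure s I (s i) :=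
  le_extClosure _ _ ⟨(⟨i, hi⟩ : I)⟩

variable {I} in
lemma homZero_subClosure {i : ι} (hi : i ∉ I) {X : C} (hX : subClosure s I X) :
    HomZero (s i) X 0 :=
  HomZero.extClosure_right (fun _ ⟨j⟩ => homZero_zero_iff.2
    (hs.hom_eq_zero _ _ (fun h => hi (h ▸ j.2)))) X hX

/-- Extension closures of subfamilies are closed under subobjects and quotients. -/
lemma serre {X Y Z : C} {f : X ⟶ Y} {g : Y ⟶ Z} {h : Z ⟶ X⟦(1 : ℤ)⟧}
    (hT : Triangle.mk f g h ∈ distTriang C) (hX : extClosure (.ofObj s) X)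
    (hY : subClosure s I Y) (hZ : extClosure (.ofObj s) Z) :
    subClosure s I X ∧ subClosure s I Z := by
  obtain ⟨n, hX⟩ := hX
  induction n generalizing X Y with
  | zero =>
    exact ⟨extClosure_of_isZero _ hX,
      (prop_of_triangle_isZero₁ (P := extClosure _) hT hX).1 hY⟩
  | succ n ih =>
    obtain ⟨S', X', a, b, c, hT', ⟨⟨i⟩⟩ | hS', hX'⟩ := extIter_succ_le n _ hX
    -- The bottom factor `s i` of `X` embeds in `Y`, which forces `i ∈ I`. Dividing `X` and `Y` by
    -- it leaves `Z` unchanged and shortens `X`.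
    · have haf : a ≫ f ≠ 0 := fun h0 => by
        have ha := eq_zero_of_comp_mor₁ hT (hs.closure_neg _ _ (hs.closure_mem i) hZ) a h0
        exact hs.id_ne_zero i (eq_zero_of_comp_mor₁ hT'
          (hs.closure_neg _ _ (hs.closure_mem i) ⟨n, hX'⟩) _ (by rw [ha, comp_zero]))
      have hi : i ∈ I := by
        by_contra hi
        exact haf (homZero_zero_iff.1 (hs.homZero_subClosure hi hY) _)
      obtain ⟨Y', g', h', hY', hTY⟩ :=
        (hs.restrict I).infl_of_ne_zero (i := ⟨i, hi⟩) (f := a ≫ f) hY haf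
      have o := Triangulated.someOctahedron rfl hT' hT hTY
      obtain ⟨h₁, h₂⟩ := ih o.mem hY' hX'
      exact ⟨extClosure_ext _ ⟨_, _, _, _, _, hT', subClosure_mem hi, h₁⟩, h₂⟩
    · exact ih hT hY ((prop_of_triangle_isZero₁ hT' hS').2 hX')

lemma exists_ne_zero_of_not_rightOrthogonal {Y : C}
    (hY : ¬ (subClosure s I).rightOrthogonal Y) : ∃ i ∈ I, ∃ f : s i ⟶ Y, f ≠ 0 := by
  by_contra! h
  refine hY (fun X f hX => ?_)
  exact homZero_zero_iff.1 (HomZero.extClosure_left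
    (fun _ ⟨i⟩ => homZero_zero_iff.2 (h i i.2)) X hX) f

/-- As long as some `s i` with `i ∈ I` maps nontrivially to `X`, divide by it; the length drops. The
bound on the length of `F` feeds the induction in `IsLeftTilt.torsionFree_le`. -/
lemma exists_torsion {n : ℕ} {X : C} (hX : extIter (.ofObj s) n X) :
    ∃ (T F : C) (f : T ⟶ X) (g : X ⟶ F) (h : F ⟶ T⟦(1 : ℤ)⟧),
      Triangle.mk f g h ∈ distTriang C ∧ subClosure s I T ∧ (subClosure s I).rightOrthogonal F ∧
        extIter (.ofObj s) n F := by
  by_cases hX₀ : (subClosure s I).rightOrthogonal X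
  · exact ⟨0, X, 0, 𝟙 X, 0, contractible_distinguished₁ X,
      extClosure_of_isZero _ (isZero_zero C), hX₀, hX⟩
  · obtain ⟨i, hi, f, hf⟩ := hs.exists_ne_zero_of_not_rightOrthogonal I hX₀
    obtain ⟨X', g, h, hT⟩ := distinguished_cocone_triangle f
    obtain ⟨m, rfl, hX'⟩ := hs.cone_extIter hX hf hT
    obtain ⟨T', F, a, b, c, hT', hTT, hF, hFm⟩ := exists_torsion hX'
    obtain ⟨T, k, l, hT''⟩ := distinguished_cocone_triangle₁ (g ≫ b)
    have o := Triangulated.someOctahedron' rfl hT hT' hT''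
    exact ⟨_, _, _, _, _, hT'', extClosure_ext _ ⟨_, _, _, _, _, o.mem, subClosure_mem hi, hTT⟩,
      hF, extIter_le_succ _ _ _ hFm⟩
termination_by n

/-- The dual decomposition, used to rewrite the last factor of the tower in
`IsSimpleMindedSystem.leftTilt`. -/
lemma exists_cotorsion {n : ℕ} {X : C} (hX : extIter (.ofObj s) n X) :
    ∃ (G T : C) (f : G ⟶ X) (g : X ⟶ T) (h : T ⟶ G⟦(1 : ℤ)⟧),
      Triangle.mk f g h ∈ distTriang C ∧ subClosure s I T ∧ (subClosure s I).leftOrthogonal G ∧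
        extClosure (.ofObj s) G := by
  induction n generalizing X with
  | zero =>
    exact ⟨X, 0, 𝟙 X, 0, 0, contractible_distinguished X, extClosure_of_isZero _ (isZero_zero C),
      fun _ _ _ => IsZero.eq_of_src hX _ _, ⟨0, hX⟩⟩
  | succ n ih =>
    obtain ⟨S', X', a, b, c, hT, hS', hX'⟩ := extIter_succ_le n _ hX
    obtain ⟨G', T', a', b', c', hT', hTT', hG', hGS'⟩ := ih hX'
    obtain ⟨Q, k, l, hTQ⟩ := distinguished_cocone_triangle₁ (b ≫ b')
    have o := Triangulated.someOctahedron' rfl hT hT' hTQ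
    have hQS : extClosure (.ofObj s) Q := extClosure_ext _ ⟨_, _, _, _, _, o.mem,
      hS'.elim (le_extClosure _ _) (extClosure_of_isZero _), hGS'⟩
    by_cases hQ : (subClosure s I).leftOrthogonal Q
    · exact ⟨_, _, _, _, _, hTQ, hTT', hQ, hQS⟩
    · obtain ⟨j, y, hy⟩ : ∃ (j : I) (y : Q ⟶ s j), y ≠ 0 := by
        by_contra! h
        refine hQ (fun Z f hZ => ?_)
        exact homZero_zero_iff.1 (HomZero.extClosure_right
          (fun _ ⟨i⟩ => homZero_zero_iff.2 (h i)) Z hZ) f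
      -- As `G'` has no maps to `s j`, the map `y` is nonzero, hence invertible, on the subobject
      -- `S'`. So `y` splits off `S'`, and its cocone is isomorphic to `G'`.
      have hmy : o.m₁ ≫ y ≠ 0 := fun h0 => by
        obtain ⟨z, rfl⟩ := tri_desc₂ o.mem y h0
        exact hy (by rw [hG' z (subClosure_mem j.2), comp_zero])
      obtain ⟨i⟩ : ObjectProperty.ofObj s S' :=
        hS'.resolve_right (fun h0 => hmy (h0.eq_of_src _ _))
      have : IsIso (o.m₁ ≫ y) := hs.isIso_of_ne_zero hmy
      obtain ⟨G, u, v, hTG⟩ := distinguished_cocone_triangle₁ y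
      have hT₀ : Triangle.mk (o.m₁ ≫ y) (0 : s j ⟶ 0) 0 ∈ distTriang C :=
        (Triangle.distinguished_iff_of_isZero₃ (Triangle.mk (o.m₁ ≫ y) 0 0) (isZero_zero C)).2 ‹_›
      have o' := Triangulated.someOctahedron rfl o.mem (tri_rot hTG) hT₀
      have : IsIso ((-u⟦(1 : ℤ)⟧') ≫ o.m₃⟦(1 : ℤ)⟧') :=
        (Triangle.isZero₂_iff_isIso₃ _ o'.mem).1 (isZero_zero C)
      let e : G ≅ G' := (shiftFunctor C (1 : ℤ)).preimageIso
        (asIso ((-u⟦(1 : ℤ)⟧') ≫ o.m₃⟦(1 : ℤ)⟧'))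
      obtain ⟨T, g, h, hT''⟩ := distinguished_cocone_triangle (u ≫ k)
      have o'' := Triangulated.someOctahedron rfl hTG hTQ hT''
      exact ⟨_, _, _, _, _, hT'', extClosure_ext _ ⟨_, _, _, _, _, o''.mem,
        subClosure_mem j.2, hTT'⟩, ObjectProperty.prop_of_iso _ e.symm hG',
        ObjectProperty.prop_of_iso _ e.symm hGS'⟩

end Sub

end IsSemibrick

end Bricks

/-! ### Serre duality as a vanishing criterion. -/

section CalabiYau

variable {C : Type u} [Category.{v} C] [Preadditive C] [HasShift C ℤ]

lemma IsCalabiYau.homZero_iff {k : Type*} [Field k] [Linear k C] {d : ℤ}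
    (h : IsCalabiYau k C d) (X Y : C) : HomZero X Y 0 ↔ HomZero Y X d := by
  obtain ⟨φ, -, -⟩ := h
  rw [homZero_zero_iff]
  constructor
  · intro h f
    rw [← Module.forall_dual_apply_eq_zero_iff k]
    intro l
    obtain ⟨g, rfl⟩ := (φ X Y).surjective l
    rw [h g, map_zero, LinearMap.zero_apply]
  · intro h f
    rw [← (φ X Y).map_eq_zero_iff]
    ext g
    rw [h g, map_zero, LinearMap.zero_apply]

end CalabiYau

/-! ### Covers, tilt triangles and orthogonality of the left tilt. -/

section Tilting

variable {C : Type u} [Category.{v} C] [Preadditive C] [HasZeroObject C] [HasShift C ℤ]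
  [∀ n : ℤ, (shiftFunctor C n).Additive] [Pretriangulated C]

lemma tri_extend₁ {X Y Z W : C} {f : X ⟶ Y} {g : Y ⟶ Z} {h : Z ⟶ X⟦(1 : ℤ)⟧}
    (hT : Triangle.mk f g h ∈ distTriang C) (hW : HomZero Z W 1) (φ : X ⟶ W) :
    ∃ ψ : Y ⟶ W, φ = f ≫ ψ :=
  Triangle.yoneda_exact₂ _ (inv_rot_of_distTriang _ hT) φ
    (homZero_zero_iff.1 ((HomZero.shift_left_iff (m := 1) (a := -1) (by lia)).2 hW) _)

/-- The cone of a cover receives no morphisms from the objects of an extension closed class. -/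
lemma IsCover.comp_cone_eq_zero {P : ObjectProperty C} (hP : P.extensionProduct P ≤ P)
    {x c Z : C} {θ : x ⟶ c} {a : c ⟶ Z} {b : Z ⟶ x⟦(1 : ℤ)⟧} (hθ : IsCover P θ)
    (hT : Triangle.mk θ a b ∈ distTriang C) {y : C} (hy : P y) (φ : y ⟶ Z) : φ = 0 := by
  -- Wakamatsu's argument: the extension `e` of `y` by `x` lies in `P`, and its map to `c` extends
  -- `θ`. Factoring it through `θ` makes `p` split by minimality, so its class `φ ≫ b` is zero; `φ`
  -- then lifts to `c`, and so factors through `θ ≫ a = 0`.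
  obtain ⟨e, p, q, hT'⟩ := distinguished_cocone_triangle₂ (φ ≫ b)
  obtain ⟨ψ, hψ, -⟩ : ∃ ψ : e ⟶ c, p ≫ ψ = 𝟙 x ≫ θ ∧ q ≫ φ = ψ ≫ a :=
    complete_distinguished_triangle_morphism₂ _ _ hT' hT (𝟙 x) φ
      (show (φ ≫ b) ≫ (𝟙 x)⟦(1 : ℤ)⟧' = φ ≫ b by simp)
  obtain ⟨χ, rfl⟩ := hθ.factors e ψ (hP _ ⟨_, _, _, _, _, hT', hθ.mem, hy⟩)
  have := hθ.right_minimal (p ≫ χ) (by rw [Category.assoc, hψ, Category.id_comp])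
  have hb : φ ≫ b = 0 := by
    have h₀ : (φ ≫ b) ≫ p⟦(1 : ℤ)⟧' = 0 := comp_distTriang_mor_zero₃₁ _ hT'
    rw [← cancel_mono ((p ≫ χ)⟦(1 : ℤ)⟧'), zero_comp, Functor.map_comp, ← Category.assoc, h₀,
      zero_comp]
  obtain ⟨φ', rfl⟩ := tri_lift₃ hT φ hb
  obtain ⟨σ, rfl⟩ := hθ.factors y φ' hy
  rw [Category.assoc, tri_comp₁₂ hT, comp_zero]

/-- Triangles `X ⟶ L ⟶ t ⟶ Σ X` whose last morphism is a `T`-cover. -/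
structure IsTiltTriangle (T : ObjectProperty C) {X L t : C} (g : X ⟶ L) (h : L ⟶ t)
    (θ : t ⟶ X⟦(1 : ℤ)⟧) : Prop where
  cover : IsCover T θ
  mem : Triangle.mk g h θ ∈ distTriang C

/-- Suspending the `Σ⁻¹T`-cover turns it into a `T`-cover of `Σ X`, so that `L` appears as an
extension of `t` by `X`. -/
lemma isTiltTriangle_of_cover {T : ObjectProperty C} [T.IsClosedUnderIsomorphisms] {x X L : C}
    {τ : x ⟶ X} {g : X ⟶ L} {h : L ⟶ x⟦(1 : ℤ)⟧} (hτ : IsCover (shiftClass T (-1)) τ)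
    (hT : Triangle.mk τ g h ∈ distTriang C) : IsTiltTriangle T g h (-τ⟦(1 : ℤ)⟧') where
  mem := tri_rot hT
  cover :=
    { mem := (shiftClass_iff T (by lia) x).1 hτ.mem
      factors := by
        intro y f hy
        let e : (y⟦(-1 : ℤ)⟧)⟦(1 : ℤ)⟧ ≅ y := (shiftFunctorCompIsoId C (-1 : ℤ) 1 (by lia)).app y
        obtain ⟨f', hf'⟩ := (shiftFunctor C (1 : ℤ)).map_surjective (e.hom ≫ f)
        obtain ⟨σ, hσ⟩ := hτ.factors _ f' (shiftClass_shift T hy (-1))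
        refine ⟨-(e.inv ≫ σ⟦(1 : ℤ)⟧'), ?_⟩
        rw [Preadditive.neg_comp, Preadditive.comp_neg, neg_neg, Category.assoc,
          ← Functor.map_comp, hσ, hf', e.inv_hom_id_assoc]
      right_minimal := by
        intro γ hγ
        obtain ⟨γ, rfl⟩ := (shiftFunctor C (1 : ℤ)).map_surjective γ
        have := hτ.right_minimal γ ((shiftFunctor C (1 : ℤ)).map_injective (by
          rw [Functor.map_comp]
          simpa using hγ))
        infer_instance }

namespace IsTiltTriangle

variable [IsTriangulated C] {ι : Type*} {s : ι → C} (hs : IsSemibrick s) {I : Set ι} {i : ι}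
  (hi : i ∉ I) {L t : C} {g : s i ⟶ L} {h : L ⟶ t} {θ : t ⟶ (s i)⟦(1 : ℤ)⟧}
  (hL : IsTiltTriangle (subClosure s I) g h θ)

include hL

lemma homZero_one {X : C} (hX : subClosure s I X) : HomZero X L 1 :=
  hL.cover.comp_cone_eq_zero extClosure_ext (tri_rot (tri_rot hL.mem)) hX

include hs

lemma closure : extClosure (.ofObj s) L :=
  extClosure_ext _ ⟨_, _, _, _, _, hL.mem, hs.closure_mem i, subClosure_le I _ hL.cover.mem⟩

include hi

/-- Morphisms from `T` to the target `t` of the tilt which become zero in `Σ X` are zero. -/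
lemma comp_cover_ne_zero {j : ι} (hj : j ∈ I) {z : s j ⟶ t} (hz : z ≠ 0) : z ≫ θ ≠ 0 := by
  intro h0
  -- If `z ≫ θ = 0`, then `θ` factors through `t'' = t / s j`. By minimality the composite `t ⟶ t''
  -- ⟶ t` is an automorphism, yet it kills `z`.
  obtain ⟨t'', v, l, ht'', hT⟩ := (hs.restrict I).infl_of_ne_zero (i := ⟨j, hj⟩) (f := z)
    hL.cover.mem hz
  obtain ⟨ρ, hρ⟩ := tri_desc₂ hT θ h0
  obtain ⟨σ, rfl⟩ := hL.cover.factors t'' ρ ht''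
  have := hL.cover.right_minimal (v ≫ σ) (by rw [Category.assoc, ← hρ])
  apply hz
  rw [← cancel_mono (v ≫ σ), reassoc_of% (tri_comp₁₂ hT), zero_comp, zero_comp]

lemma homZero_zero {X : C} (hX : subClosure s I X) : HomZero X L 0 := by
  refine HomZero.extClosure_left ?_ X hX
  rintro _ ⟨⟨j, hj⟩⟩
  refine homZero_zero_iff.2 (fun (z : s j ⟶ L) => ?_)
  have hz : z ≫ h = 0 := by
    by_contra hz
    exact hL.comp_cover_ne_zero hs hi hj hz (by rw [Category.assoc, tri_comp₂₃ hL.mem, comp_zero])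
  obtain ⟨z', rfl⟩ := tri_lift₂ hL.mem z hz
  rw [hs.hom_eq_zero j i (fun h => hi (h ▸ hj)) z', zero_comp]

lemma rightOrthogonal : (subClosure s I).rightOrthogonal L :=
  fun _ f hX => homZero_zero_iff.1 (hL.homZero_zero hs hi hX) f

lemma id_ne_zero : 𝟙 L ≠ 0 := by
  intro h0
  refine hs.id_ne_zero i (eq_zero_of_comp_mor₁ hL.mem (hs.closure_neg _ _ (hs.closure_mem i)
    (subClosure_le I _ hL.cover.mem)) _ ?_)
  rw [Category.id_comp, ← Category.comp_id g, h0, comp_zero]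

end IsTiltTriangle

namespace IsTiltTriangle

variable [IsTriangulated C] {ι : Type*} {s : ι → C} (hs : IsSemibrick s) {I : Set ι} {i : ι}
  (hi : i ∉ I) {L t : C} {g : s i ⟶ L} {h : L ⟶ t} {θ : t ⟶ (s i)⟦(1 : ℤ)⟧}
  (hL : IsTiltTriangle (subClosure s I) g h θ)
  {j : ι} (hj : j ∉ I) {L' t' : C} {g' : s j ⟶ L'} {h' : L' ⟶ t'}
  {θ' : t' ⟶ (s j)⟦(1 : ℤ)⟧} (hL' : IsTiltTriangle (subClosure s I) g' h' θ')

include hs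

-- Together with `exists_descent`: a morphism between tilted objects is determined by the morphism
-- `s i ⟶ s j` it induces, which transfers Schur's lemma to the tilt.
include hL hj hL' in
lemma eq_zero_of_comp {f : L ⟶ L'} (hf : g ≫ f = 0) : f = 0 := by
  obtain ⟨φ, rfl⟩ := tri_desc₂ hL.mem f hf
  rw [hL'.rightOrthogonal hs hj φ hL.cover.mem, comp_zero]

include hi hL' in
lemma exists_descent (f : L ⟶ L') : ∃ φ : s i ⟶ s j, g ≫ f = φ ≫ g' :=
  tri_lift₂ hL'.mem (g ≫ f) (homZero_zero_iff.1 (hs.homZero_subClosure hi hL'.cover.mem) _)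

include hi hL hj hL' in
lemma hom_eq_zero (hij : i ≠ j) (f : L ⟶ L') : f = 0 := by
  obtain ⟨φ, hφ⟩ := exists_descent (g := g) hs hi hL' f
  refine eq_zero_of_comp hs hL hj hL' ?_
  rw [hφ, hs.hom_eq_zero i j hij φ, zero_comp]

include hi hL in
lemma isIso {f : L ⟶ L} (hf : f ≠ 0) : IsIso f := by
  obtain ⟨φ, hφ⟩ := exists_descent (g := g) hs hi hL f
  have : IsIso φ := hs.isIso i φ (fun h0 => hf (eq_zero_of_comp hs hL hi hL (by
    rw [hφ, h0, zero_comp])))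
  -- The inverse is an extension of `inv φ ≫ g` along `g`; the obstruction lies in `Hom(t, Σ L) =
  -- 0`.
  obtain ⟨f', hf'⟩ := tri_extend₁ hL.mem (hL.homZero_one hL.cover.mem) (inv φ ≫ g)
  refine ⟨f', ?_, ?_⟩
  · rw [← sub_eq_zero]
    refine eq_zero_of_comp hs hL hi hL ?_
    rw [Preadditive.comp_sub, reassoc_of% hφ, ← hf', IsIso.hom_inv_id_assoc, Category.comp_id,
      sub_self]
  · rw [← sub_eq_zero]
    refine eq_zero_of_comp hs hL hi hL ?_
    rw [Preadditive.comp_sub, ← reassoc_of% hf', hφ, IsIso.inv_hom_id_assoc, Category.comp_id,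
      sub_self]

end IsTiltTriangle

lemma IsLeftTilt.exists_triangle {ι : Type*} {s : ι → C} {I : Set ι} {L : ι → C}
    (hL : IsLeftTilt s I L) {i : ι} (hi : i ∉ I) :
    ∃ (t : C) (g : s i ⟶ L i) (h : L i ⟶ t) (θ : t ⟶ (s i)⟦(1 : ℤ)⟧),
      IsTiltTriangle (subClosure s I) g h θ := by
  obtain ⟨x, τ, g, h, hτ, hT⟩ := hL.triangle_of_notMem i hi
  have : (subClosure s I).IsClosedUnderIsomorphisms :=
    inferInstanceAs (extClosure _).IsClosedUnderIsomorphisms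
  exact ⟨_, _, _, _, isTiltTriangle_of_cover hτ hT⟩

lemma LeftTiltDefined.exists_leftTilt {ι : Type*} {s : ι → C} {I : Set ι}
    (h : LeftTiltDefined s I) : ∃ L : ι → C, IsLeftTilt s I L := by
  have (i : ι) : ∃ L : C, (i ∈ I → Nonempty (L ≅ (s i)⟦(-1 : ℤ)⟧)) ∧
      (i ∉ I → ∃ (x : C) (τ : x ⟶ s i) (g : s i ⟶ L) (h : L ⟶ x⟦(1 : ℤ)⟧),
        IsCover (shiftClass (subClosure s I) (-1)) τ ∧ Triangle.mk τ g h ∈ distTriang C) := by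
    by_cases hi : i ∈ I
    · exact ⟨_, fun _ => ⟨Iso.refl _⟩, fun hi' => (hi' hi).elim⟩
    · obtain ⟨x, τ, hτ⟩ := h i hi
      obtain ⟨L, g, h, hT⟩ := distinguished_cocone_triangle τ
      exact ⟨L, fun hi' => (hi hi').elim, fun _ => ⟨x, τ, g, h, hτ, hT⟩⟩
  choose L hL₁ hL₂ using this
  exact ⟨L, hL₁, hL₂⟩

variable [IsTriangulated C]

namespace IsOrthogonalCollection

variable {w : ℕ} (hw : 2 ≤ w) {ι : Type*} {s : ι → C} (hs : IsOrthogonalCollection w s)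

include hs

include hw in
lemma isSemibrick : IsSemibrick s where
  id_ne_zero i := have := hs.nontrivial_end i; by
    intro h
    obtain ⟨f, hf⟩ := exists_ne (0 : s i ⟶ s i)
    exact hf (by rw [← Category.comp_id f, h, comp_zero])
  isIso := hs.isIso_of_ne_zero
  hom_eq_zero := hs.hom_eq_zero
  -- `w ≥ 2` is what puts `-1` in the range `-w+1, …, -1`.
  neg i j := hs.hom_shift_eq_zero i j (-1) (by lia) (by lia)

lemma closure_homZero {l : ℤ} (h₁ : -(w : ℤ) + 1 ≤ l) (h₂ : l ≤ -1) {X Y : C}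
    (hX : extClosure (.ofObj s) X) (hY : extClosure (.ofObj s) Y) : HomZero X Y l :=
  HomZero.extClosure_left (fun _ ⟨i⟩ => HomZero.extClosure_right
    (fun _ ⟨j⟩ => hs.hom_shift_eq_zero i j l h₁ h₂) Y hY) X hX

variable {I : Set ι} {i : ι} (hi : i ∉ I) {L t : C} {g : s i ⟶ L} {h : L ⟶ t}
  {θ : t ⟶ (s i)⟦(1 : ℤ)⟧} (hL : IsTiltTriangle (subClosure s I) g h θ)

include hw hi hL

lemma homZero_tilt {m : ℤ} (h₁ : -(w : ℤ) + 2 ≤ m) (h₂ : m ≤ 1) {X : C}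
    (hX : subClosure s I X) : HomZero X L m := by
  obtain rfl | rfl | hm : m = 1 ∨ m = 0 ∨ m ≤ -1 := by lia
  · exact hL.homZero_one hX
  · exact hL.homZero_zero (hs.isSemibrick hw) hi hX
  · exact hs.closure_homZero (by lia) hm (subClosure_le I _ hX)
      (hL.closure (hs.isSemibrick hw))

variable (hCY : ∀ X Y : C, HomZero X Y 0 ↔ HomZero Y X (-(w : ℤ)))

include hCY

/-- The degree `-w` is dual to `Hom(X, L) = 0`; the other degrees follow from orthogonality, as `L`
lies in `⟨S⟩`. -/
lemma tilt_homZero {m : ℤ} (h₁ : -(w : ℤ) ≤ m) (h₂ : m ≤ -1) {X : C}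
    (hX : subClosure s I X) : HomZero L X m := by
  obtain rfl | hm : m = -(w : ℤ) ∨ -(w : ℤ) + 1 ≤ m := by lia
  · exact (hCY _ _).1 (hs.homZero_tilt hw hi hL (by lia) (by lia) hX)
  · exact hs.closure_homZero hm h₂ (hL.closure (hs.isSemibrick hw)) (subClosure_le I _ hX)

omit hi hL in
lemma leftTilt {L : ι → C} (hL : IsLeftTilt s I L) : IsOrthogonalCollection w L := by
  have hs' := hs.isSemibrick hw
  have hom (i j : ι) (m : ℤ) (h₁ : -(w : ℤ) + 1 ≤ m) (h₂ : m ≤ -1 ∨ m = 0 ∧ i ≠ j) :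
      HomZero (L i) (L j) m := by
    by_cases hi : i ∈ I
    · obtain ⟨e⟩ := hL.iso_of_mem i hi
      refine HomZero.of_iso ?_ e.symm (Iso.refl _)
      rw [HomZero.shift_left_iff (m := m + 1) (by lia)]
      by_cases hj : j ∈ I
      · obtain ⟨e'⟩ := hL.iso_of_mem j hj
        refine HomZero.of_iso ?_ (Iso.refl _) e'.symm
        rw [HomZero.shift_right_iff (m := m) (by lia)]
        obtain h₂ | ⟨rfl, h₂⟩ := h₂
        · exact hs.hom_shift_eq_zero i j m h₁ h₂
        · exact homZero_zero_iff.2 (hs.hom_eq_zero i j h₂)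
      · obtain ⟨t, g, h, θ, hj'⟩ := hL.exists_triangle hj
        exact hs.homZero_tilt hw hj hj' (by lia) (by lia) (subClosure_mem hi)
    · obtain ⟨t, g, h, θ, hi'⟩ := hL.exists_triangle hi
      by_cases hj : j ∈ I
      · obtain ⟨e'⟩ := hL.iso_of_mem j hj
        refine HomZero.of_iso ?_ (Iso.refl _) e'.symm
        -- The shift of `s j` lowers the degree by one: `m = -w+1` becomes the boundary degree `-w`,
        -- and `m = 0` becomes `-1`.
        rw [HomZero.shift_right_iff (m := m - 1) (by lia)]
        exact hs.tilt_homZero hw hi hi' hCY (by lia) (by lia) (subClosure_mem hj)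
      · obtain ⟨t', g', h', θ', hj'⟩ := hL.exists_triangle hj
        obtain h₂ | ⟨rfl, h₂⟩ := h₂
        · exact hs.closure_homZero h₁ h₂ (hi'.closure hs') (hj'.closure hs')
        · exact homZero_zero_iff.2 (IsTiltTriangle.hom_eq_zero hs' hi hi' hj hj' h₂)
  refine ⟨hs.finite, fun i => ?_, fun i f hf => ?_,
    fun i j hij => homZero_zero_iff.1 (hom i j 0 (by lia) (Or.inr ⟨rfl, hij⟩)),
    fun i j l h₁ h₂ => hom i j l h₁ (Or.inl h₂)⟩
  · refine ⟨𝟙 _, 0, ?_⟩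
    by_cases hi : i ∈ I
    · obtain ⟨e⟩ := hL.iso_of_mem i hi
      intro h
      refine hs'.id_ne_zero i ((shiftFunctor C (-1 : ℤ)).map_injective ?_)
      rw [Functor.map_zero, CategoryTheory.Functor.map_id, ← e.inv_hom_id, ← Category.id_comp e.hom,
        h, zero_comp, comp_zero]
    · obtain ⟨t, g, h, θ, hi'⟩ := hL.exists_triangle hi
      exact hi'.id_ne_zero hs' hi
  · by_cases hi : i ∈ I
    · obtain ⟨e⟩ := hL.iso_of_mem i hi
      obtain ⟨φ, hφ⟩ := (shiftFunctor C (-1 : ℤ)).map_surjective (e.inv ≫ f ≫ e.hom)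
      have : IsIso φ := hs'.isIso i φ (fun h0 => hf (by
        rw [h0, Functor.map_zero] at hφ
        rw [← cancel_epi e.inv, ← cancel_mono e.hom, Category.assoc, ← hφ]
        simp))
      have h : f = e.hom ≫ φ⟦(-1 : ℤ)⟧' ≫ e.inv := by simp [hφ]
      rw [h]
      infer_instance
    · obtain ⟨t, g, h, θ, hi'⟩ := hL.exists_triangle hi
      exact hi'.isIso hs' hi hf

end IsOrthogonalCollection

end Tilting

/-! ### The torsion pairs before and after tilting. -/

section TorsionPairs

variable {C : Type u} [Category.{v} C] [Preadditive C] [HasZeroObject C] [HasShift C ℤ]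
  [∀ n : ℤ, (shiftFunctor C n).Additive] [Pretriangulated C] [IsTriangulated C]

instance {ι : Type*} (s : ι → C) (I : Set ι) : (subClosure s I).IsClosedUnderIsomorphisms :=
  inferInstanceAs (extClosure _).IsClosedUnderIsomorphisms

/-- The torsion free class `⟨S'⟩^⊥ ∩ ⟨S⟩`. -/
def torsionFree {ι : Type*} (s : ι → C) (I : Set ι) : ObjectProperty C :=
  (subClosure s I).rightOrthogonal ⊓ extClosure (.ofObj s)

instance {ι : Type*} (s : ι → C) (I : Set ι) : (torsionFree s I).IsClosedUnderIsomorphisms where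
  of_iso e h := ⟨ObjectProperty.prop_of_iso _ e h.1, ObjectProperty.prop_of_iso _ e h.2⟩

lemma rightOrthogonal_iff_homZero (P : ObjectProperty C) (Y : C) :
    P.rightOrthogonal Y ↔ ∀ X, P X → HomZero X Y 0 :=
  ⟨fun h _ hX => homZero_zero_iff.2 (fun f => h f hX),
    fun h _ f hX => homZero_zero_iff.1 (h _ hX) f⟩

lemma rightOrthogonal_ext (P : ObjectProperty C) :
    P.rightOrthogonal.extensionProduct P.rightOrthogonal ≤ P.rightOrthogonal := by
  rintro X ⟨Y, Z, f, g, h, hT, hY, hZ⟩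
  rw [rightOrthogonal_iff_homZero] at hY hZ ⊢
  exact fun W hW => HomZero.right₂ hT (hY W hW) (hZ W hW)

lemma torsionFree_ext {ι : Type*} (s : ι → C) (I : Set ι) :
    (torsionFree s I).extensionProduct (torsionFree s I) ≤ torsionFree s I := by
  rintro X ⟨Y, Z, f, g, h, hT, hY, hZ⟩
  exact ⟨rightOrthogonal_ext _ _ ⟨Y, Z, f, g, h, hT, hY.1, hZ.1⟩,
    extClosure_ext _ ⟨Y, Z, f, g, h, hT, hY.2, hZ.2⟩⟩

lemma shiftClass_ext {P : ObjectProperty C} (hP : P.extensionProduct P ≤ P) (n : ℤ) :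
    (shiftClass P n).extensionProduct (shiftClass P n) ≤ shiftClass P n := by
  rw [← shiftClass_extensionProduct]
  exact shiftClass_mono hP n

lemma IsAdmissible.isTorsionPairIn {A T F : ObjectProperty C} (hA : IsAdmissible A)
    [T.IsClosedUnderIsomorphisms] [F.IsClosedUnderIsomorphisms] (hT : T ≤ A) (hF : F ≤ A)
    (hTF : ∀ (X Y : C) (f : X ⟶ Y), T X → F Y → f = 0) (h : A ≤ T.extensionProduct F) :
    IsTorsionPairIn A T F where
  left_le := hT
  right_le := hF
  isTorsionPair :=
    { isClosedUnderIsomorphisms_left := inferInstance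
      isClosedUnderIsomorphisms_right := inferInstance
      hom_eq_zero f hx hy := by
        ext
        exact hTF _ _ f.hom hx hy
      exists_shortExact X := by
        obtain ⟨t, f, i, p, d, hT', ht, hf⟩ := h _ X.2
        obtain ⟨w, hw⟩ := hA.isProperAbelian.shortExact_of_triangle
          (a := ⟨t, hT _ ht⟩) (b := X) (c := ⟨f, hF _ hf⟩) (ObjectProperty.homMk i)
          (ObjectProperty.homMk p) d hT'
        exact ⟨_, _, _, _, w, ht, hf, hw⟩ }

section

variable {ι : Type*} {s : ι → C} (hs : IsSemibrick s) (I : Set ι)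

include hs

lemma IsSemibrick.isClosedUnderSubobjects :
    ((subClosure s I).inverseImage (extClosure (.ofObj s)).ι).IsClosedUnderSubobjects where
  prop_of_mono {X Y} f _ hY := by
    obtain ⟨Z, g, h, hZ, hT⟩ := hs.isAdmissible.infl_of_mono f
    exact (hs.serre I hT X.2 hY hZ).1

lemma IsSemibrick.isClosedUnderQuotients :
    ((subClosure s I).inverseImage (extClosure (.ofObj s)).ι).IsClosedUnderQuotients where
  prop_of_epi {X Y} f _ hX := by
    obtain ⟨Z, g, h, hZ, hT⟩ := hs.isAdmissible.defl_of_epi f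
    exact (hs.serre I hT hZ hX Y.2).2

lemma IsSemibrick.le_torsion_extensionProduct :
    extClosure (.ofObj s) ≤ (subClosure s I).extensionProduct (torsionFree s I) := by
  rintro X ⟨n, hX⟩
  obtain ⟨T, F, f, g, h, hT, hTT, hF, hF'⟩ := hs.exists_torsion I hX
  exact ⟨T, F, f, g, h, hT, hTT, hF, n, hF'⟩

lemma IsSemibrick.isTorsionPairIn :
    IsTorsionPairIn (extClosure (.ofObj s)) (subClosure s I) (torsionFree s I) :=
  hs.isAdmissible.isTorsionPairIn (subClosure_le I) inf_le_right
    (fun _ _ f hX hY => hY.1 f hX) (hs.le_torsion_extensionProduct I)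

/-- The extensions of torsion free objects by negative shifts of torsion objects can be
reordered. -/
lemma IsSemibrick.swap :
    (shiftClass (subClosure s I) (-1)).extensionProduct (torsionFree s I) ≤
      (torsionFree s I).extensionProduct (shiftClass (subClosure s I) (-1)) := by
  rintro E ⟨T, F, a, b, u, hT, hTT, hF⟩
  have hA := hs.isAdmissible
  rw [shiftClass_iff _ (m := 1) (by lia)] at hTT
  -- The connecting map `u : F ⟶ Σ T` is a morphism of `⟨S⟩`; with kernel `K` and cokernel `Q`, the
  -- octahedron presents `E` as an extension of `Σ⁻¹Q` by `K`.
  obtain ⟨J, p, m, hJ, ⟨K, k, k', hK, hTp⟩, ⟨Q, q, q', hQ, hTm⟩, rfl⟩ :=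
    hA.fact _ _ u hF.2 (subClosure_le I _ hTT)
  obtain ⟨-, hQT⟩ := hs.serre I hTm hJ hTT hQ
  obtain ⟨δ, δ', hTm'⟩ := tri_inv_rot hTm
  have o := Triangulated.someOctahedron' rfl hTp hTm' (tri_rot hT)
  refine ⟨_, _, _, _, _, o.mem, ⟨?_, hK⟩, shiftClass_shift _ hQT (-1)⟩
  have hF₁ := hF.1
  rw [rightOrthogonal_iff_homZero] at hF₁ ⊢
  exact fun X hX => HomZero.right₁ hTp (hF₁ X hX)
    (hA.neg _ _ (subClosure_le I _ hX) hJ) (by lia)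

end

section

variable {ι : Type*} {s : ι → C} (hs : IsSemibrick s) {I : Set ι} {L : ι → C}
  (hL : IsLeftTilt s I L)

include hL

/-- Hence `Σ⁻¹T` is the closure of a subfamily of the tilt, and its closure under quotients is the
Serre property for `L`. -/
lemma IsLeftTilt.subClosure_eq : subClosure L I = shiftClass (subClosure s I) (-1) := by
  refine le_antisymm (extClosure_le (fun X hX => ?_) ?_ (shiftClass_ext extClosure_ext _)) ?_
  · rw [shiftClass_iff _ (m := 1) (by lia)]
    exact extClosure_of_isZero _ ((shiftFunctor C (1 : ℤ)).map_isZero hX)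
  · rintro _ ⟨i⟩
    obtain ⟨e⟩ := hL.iso_of_mem i i.2
    exact ⟨s i, subClosure_mem i.2, ⟨e.symm⟩⟩
  · refine shiftClass_extClosure_le (-1) ?_
    rintro _ ⟨_, ⟨i⟩, ⟨e⟩⟩
    obtain ⟨e'⟩ := hL.iso_of_mem i i.2
    exact ObjectProperty.prop_of_iso _ (e' ≪≫ e) (subClosure_mem (s := L) i.2)

lemma IsLeftTilt.shiftClass_le :
    shiftClass (subClosure s I) (-1) ≤ extClosure (.ofObj L) := by
  rw [← hL.subClosure_eq]
  exact subClosure_le I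

include hs

lemma IsLeftTilt.le_extensionProduct :
    extClosure (.ofObj L) ≤
      (torsionFree s I).extensionProduct (shiftClass (subClosure s I) (-1)) := by
  have hz (X : C) (hX : IsZero X) : torsionFree s I X :=
    ⟨fun _ _ _ => hX.eq_of_tgt _ _, extClosure_of_isZero _ hX⟩
  have hz' (X : C) (hX : IsZero X) : shiftClass (subClosure s I) (-1) X := by
    rw [shiftClass_iff _ (m := 1) (by lia)]
    exact extClosure_of_isZero _ ((shiftFunctor C (1 : ℤ)).map_isZero hX)
  have : (torsionFree s I).ContainsZero := ⟨0, isZero_zero C, hz _ (isZero_zero C)⟩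
  have : (shiftClass (subClosure s I) (-1)).ContainsZero :=
    ⟨0, isZero_zero C, hz' _ (isZero_zero C)⟩
  refine extClosure_le (fun X hX => ObjectProperty.le_extensionProduct_left _ _ (hz X hX)) ?_ ?_
  · rintro _ ⟨i⟩
    by_cases hi : i ∈ I
    · obtain ⟨e⟩ := hL.iso_of_mem i hi
      exact ObjectProperty.le_extensionProduct_right _ _ ⟨s i, subClosure_mem hi, ⟨e.symm⟩⟩
    · obtain ⟨t, g, h, θ, hi'⟩ := hL.exists_triangle hi
      exact ObjectProperty.le_extensionProduct_left _ _
        ⟨hi'.rightOrthogonal hs hi, hi'.closure hs⟩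
  -- With `U = Σ⁻¹T`: `(F * U) * (F * U) = F * (U * F) * U ⊆ F * (F * U) * U ⊆ F * U`.
  · rw [ObjectProperty.extensionProduct_assoc, ← ObjectProperty.extensionProduct_assoc _ _
      (shiftClass (subClosure s I) (-1))]
    refine (ObjectProperty.monotone_extensionProduct_right _
      (ObjectProperty.monotone_extensionProduct_left _ (hs.swap I))).trans ?_
    rw [ObjectProperty.extensionProduct_assoc, ← ObjectProperty.extensionProduct_assoc]
    exact extensionProduct_mono (torsionFree_ext s I) (shiftClass_ext extClosure_ext _)

/-- Induction on length: a torsion-free `X ≠ 0` contains some `s i` with `i ∉ I`. The preimage `E`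
of the torsion part `T` of `X / s i` is an extension of `L i` by an object of `Σ⁻¹⟨S'⟩`, and `X / E`
is torsion-free and shorter. -/
lemma IsLeftTilt.torsionFree_le : torsionFree s I ≤ extClosure (.ofObj L) := by
  suffices ∀ (n : ℕ) (X : C), extIter (.ofObj s) n X → (subClosure s I).rightOrthogonal X →
      extClosure (.ofObj L) X by
    rintro X ⟨hX, n, hn⟩
    exact this n X hn hX
  intro n
  induction n with
  | zero => exact fun X hX _ => extClosure_of_isZero _ hX
  | succ n ih =>
    intro X hX hX₁
    by_cases hX₀ : ∀ (i : ι) (f : s i ⟶ X), f = 0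
    · refine extClosure_of_isZero _ ?_
      rw [IsZero.iff_id_eq_zero]
      exact homZero_zero_iff.1 (HomZero.extClosure_left
        (fun _ ⟨i⟩ => homZero_zero_iff.2 (hX₀ i)) X ⟨_, hX⟩) _
    · push Not at hX₀
      obtain ⟨i, f, hf⟩ := hX₀
      have hi : i ∉ I := fun hi => hf (hX₁ f (subClosure_mem hi))
      obtain ⟨Y, g, h, hT⟩ := distinguished_cocone_triangle f
      obtain ⟨m, hm, hY⟩ := hs.cone_extIter hX hf hT
      obtain rfl : m = n := by lia
      obtain ⟨T, Z, a, b, c, hT', hTT, hZ, hZn⟩ := hs.exists_torsion I hY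
      obtain ⟨E, u, l, hTE⟩ := distinguished_cocone_triangle₁ (g ≫ b)
      have o := Triangulated.someOctahedron' rfl hT hT' hTE
      refine extClosure_ext _ ⟨_, _, _, _, _, hTE, ?_, ih Z hZn hZ⟩
      have hE : (subClosure s I).rightOrthogonal E := by
        rw [rightOrthogonal_iff_homZero] at hX₁ ⊢
        exact fun W hW => HomZero.right₁ hTE (hX₁ W hW)
          (hs.closure_neg _ _ (subClosure_le I _ hW) ⟨_, hZn⟩) (by lia)
      obtain ⟨t, g', h', θ, hi'⟩ := hL.exists_triangle hi
      -- The class of `E` in `Hom(T, Σ s i)` factors through the cover by some `σ`. It is monic: its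
      -- kernel lifts to `E`, which is torsion-free.
      obtain ⟨σ, hσ⟩ := hi'.cover.factors T (a ≫ h) hTT
      obtain ⟨J, p, q, hJ, ⟨K, k, k', hK, hTp⟩, hq, hpq⟩ :=
        (hs.restrict I).isAdmissible.fact _ _ σ hTT hi'.cover.mem
      have hk : k = 0 := by
        obtain ⟨κ, hκ⟩ := tri_lift₃ o.mem k (by
          rw [← hσ, ← hpq, Category.assoc, reassoc_of% (tri_comp₁₂ hTp), zero_comp])
        rw [hκ, hE κ hK, zero_comp]
      have hK₀ : IsZero K := by
        rw [IsZero.iff_id_eq_zero]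
        exact eq_zero_of_comp_mor₁ hTp ((hs.restrict I).closure_neg _ _ hK hJ) _
          (by rw [hk, comp_zero])
      have : IsIso p := (Triangle.isZero₁_iff_isIso₂ _ hTp).1 hK₀
      have hσ' : Infl (subClosure s I) σ := by
        rw [← hpq]
        exact (infl_of_isIso (fun _ => extClosure_of_isZero _) p).comp extClosure_ext hq
      obtain ⟨Q, d, d', hQ, hTσ⟩ := hσ'
      -- With `Q = t / T`, this is a triangle `Σ⁻¹Q ⟶ E ⟶ L i`.
      have o' := Triangulated.someOctahedron' hσ (inv_rot_of_distTriang _ hTσ)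
        (tri_rot hi'.mem) (tri_rot o.mem)
      exact extClosure_ext _ ⟨_, _, _, _, _, o'.mem,
        hL.shiftClass_le _ (shiftClass_shift _ hQ (-1)), le_extClosure _ _ ⟨i⟩⟩

lemma IsLeftTilt.isTorsionPairIn (hs' : IsSemibrick L) :
    IsTorsionPairIn (extClosure (.ofObj L)) (torsionFree s I)
      (shiftClass (subClosure s I) (-1)) := by
  refine hs'.isAdmissible.isTorsionPairIn (hL.torsionFree_le hs) hL.shiftClass_le ?_
    (hL.le_extensionProduct hs)
  rintro X Y f hX ⟨Z, hZ, ⟨e⟩⟩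
  have := (hs.closure_neg X Z hX.2 (subClosure_le I _ hZ)) (f ≫ e.inv)
  rw [← cancel_mono e.inv, this, zero_comp]

end

end TorsionPairs

/-! ### Minimal covers from finite-dimensional Hom spaces. -/

section Covers

variable {C : Type u} [Category.{v} C] [Preadditive C] [HasZeroObject C] [HasShift C ℤ]
  [∀ n : ℤ, (shiftFunctor C n).Additive] [Pretriangulated C] [IsTriangulated C]

/-- Morphisms from an object of `A` through which all morphisms from objects of `A` factor. -/
structure IsPrecover (A : ObjectProperty C) {x c : C} (τ : x ⟶ c) : Prop where
  mem : A x
  factors : ∀ (y : C) (f : y ⟶ c), A y → ∃ g : y ⟶ x, g ≫ τ = f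

/-- Take a precover `σ` whose source has endomorphism ring of minimal dimension. If `g ≫ σ = σ` and
`g = q ≫ m` is its image factorization through `J`, then `m ≫ σ` is again a precover and `f ↦ q ≫ f
≫ m` embeds `End J` in `End y`. By minimality this is onto, and a preimage of the identity inverts
`q` and `m`. -/
lemma IsPrecover.exists_isCover (k : Type*) [Field k] [Linear k C]
    [∀ X Y : C, Module.Finite k (X ⟶ Y)] {A : ObjectProperty C} (hA : IsAdmissible A) {x c : C}
    {τ : x ⟶ c} (hτ : IsPrecover A τ) : ∃ (y : C) (σ : y ⟶ c), IsCover A σ := by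
  let p : ℕ → Prop := fun n => ∃ (y : C) (σ : y ⟶ c), IsPrecover A σ ∧
    Module.finrank k (y ⟶ y) = n
  have hp : ∃ n, p n := ⟨_, x, τ, hτ, rfl⟩
  classical
  obtain ⟨y, σ, hσ, hn⟩ := Nat.find_spec hp
  have hmin (z : C) (ρ : z ⟶ c) (hρ : IsPrecover A ρ) :
      Module.finrank k (y ⟶ y) ≤ Module.finrank k (z ⟶ z) :=
    hn.trans_le (Nat.find_min' hp ⟨z, ρ, hρ, rfl⟩)
  refine ⟨y, σ, hσ.mem, hσ.factors, fun g hg => ?_⟩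
  obtain ⟨J, q, m, hJ, hq, hm, rfl⟩ := hA.fact _ _ g hσ.mem hσ.mem
  have hJσ : IsPrecover A (m ≫ σ) := ⟨hJ, fun z f hz => by
    obtain ⟨f', rfl⟩ := hσ.factors z f hz
    exact ⟨f' ≫ q, by rw [Category.assoc, ← Category.assoc q, hg]⟩⟩
  let l : (J ⟶ J) →ₗ[k] (y ⟶ y) := Linear.leftComp k y q ∘ₗ Linear.rightComp k J m
  have hl (f : J ⟶ J) : l f = q ≫ f ≫ m := rfl
  have hinj : Function.Injective l := fun f f' hff' => by
    rw [hl, hl] at hff'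
    exact hA.cancel_infl hm hJ (hA.cancel_defl hq hσ.mem hff')
  have hsurj : Function.Surjective l :=
    (LinearMap.injective_iff_surjective_of_finrank_eq_finrank
      (le_antisymm (LinearMap.finrank_le_finrank_of_injective hinj) (hmin _ _ hJσ))).1 hinj
  obtain ⟨f, hf⟩ := hsurj (𝟙 y)
  rw [hl] at hf
  have h₁ : m ≫ q ≫ f = 𝟙 J := hA.cancel_infl hm hJ (by simp [hf])
  have h₂ : f ≫ m ≫ q = 𝟙 J := hA.cancel_defl hq hJ (by
    rw [← Category.assoc f, ← Category.assoc q, hf, Category.id_comp, Category.comp_id])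
  have hq' : IsIso q := ⟨f ≫ m, hf, by rw [Category.assoc, h₂]⟩
  have hm' : IsIso m := ⟨q ≫ f, h₁, by rw [Category.assoc, hf]⟩
  infer_instance

lemma isPrecover_of_triangle {A : ObjectProperty C} {a x y : C} {f : a ⟶ x} {g : x ⟶ y}
    {h : y ⟶ a⟦(1 : ℤ)⟧} (hT : Triangle.mk f g h ∈ distTriang C) (ha : A a)
    (hy : A.rightOrthogonal y) : IsPrecover A f where
  mem := ha
  factors z φ hz := by
    obtain ⟨ψ, hψ⟩ := tri_lift₂ hT φ (hy _ hz)
    exact ⟨ψ, hψ.symm⟩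

/-- The cone of a cover of a retract of `x` is a retract of the cone of any precover of `x`. -/
lemma IsCover.exists_retract {A : ObjectProperty C} {a₀ z y₀ a x y : C} {f₀ : a₀ ⟶ z}
    {g₀ : z ⟶ y₀} {h₀ : y₀ ⟶ a₀⟦(1 : ℤ)⟧} {f : a ⟶ x} {g : x ⟶ y}
    {h : y ⟶ a⟦(1 : ℤ)⟧} (hf₀ : IsCover A f₀) (hf : IsPrecover A f) (r : Retract z x)
    (hT₀ : Triangle.mk f₀ g₀ h₀ ∈ distTriang C) (hT : Triangle.mk f g h ∈ distTriang C) :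
    Nonempty (Retract y₀ y) := by
  obtain ⟨α, hα⟩ := hf.factors _ (f₀ ≫ r.i) hf₀.mem
  obtain ⟨β, hβ⟩ := hf₀.factors _ (f ≫ r.r) hf.mem
  have : IsIso (α ≫ β) := hf₀.right_minimal _ (by
    rw [Category.assoc, hβ, reassoc_of% hα, r.retract, Category.comp_id])
  let φ := completeDistinguishedTriangleMorphism _ _ hT₀ hT α r.i hα.symm
  let ψ := completeDistinguishedTriangleMorphism _ _ hT hT₀ β r.r hβ.symm
  have h₁ : IsIso (φ ≫ ψ).hom₁ := this
  have h₂ : IsIso (φ ≫ ψ).hom₂ := by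
    change IsIso (r.i ≫ r.r)
    rw [r.retract]
    exact inferInstanceAs (IsIso (𝟙 z))
  have h₃ : IsIso (φ ≫ ψ).hom₃ := isIso₃_of_isIso₁₂ _ hT₀ hT₀ h₁ h₂
  let a' : y₀ ⟶ y := φ.hom₃
  let b' : y ⟶ y₀ := ψ.hom₃
  have h₃ : IsIso (a' ≫ b') := h₃
  exact ⟨⟨a', b' ≫ inv (a' ≫ b'), by rw [← Category.assoc, IsIso.hom_inv_id]⟩⟩

/-- Besides stability of `A * Y` under retracts, this makes the left map of the triangle a cover;
its cone is a retract of `y`, so it stays in `Y`. -/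
lemma exists_cover_triangle (k : Type*) [Field k] [Linear k C]
    [∀ X Y : C, Module.Finite k (X ⟶ Y)] {A Y : ObjectProperty C} (hA : IsAdmissible A)
    [Y.IsStableUnderRetracts] (hY : Y ≤ A.rightOrthogonal) {z x : C} (r : Retract z x)
    (hx : A.extensionProduct Y x) :
    ∃ (a y : C) (f : a ⟶ z) (g : z ⟶ y) (h : y ⟶ a⟦(1 : ℤ)⟧),
      IsCover A f ∧ Triangle.mk f g h ∈ distTriang C ∧ Y y := by
  obtain ⟨a, y, f, g, h, hT, ha, hy⟩ := hx
  have hf := isPrecover_of_triangle hT ha (hY _ hy)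
  have hz : IsPrecover A (f ≫ r.r) := ⟨ha, fun b φ hb => by
    obtain ⟨ψ, hψ⟩ := hf.factors b (φ ≫ r.i) hb
    exact ⟨ψ, by rw [reassoc_of% hψ, r.retract, Category.comp_id]⟩⟩
  obtain ⟨a₀, f₀, hf₀⟩ := hz.exists_isCover k hA
  obtain ⟨y₀, g₀, h₀, hT₀⟩ := distinguished_cocone_triangle f₀
  obtain ⟨r'⟩ := hf₀.exists_retract hf r hT₀ hT
  exact ⟨a₀, y₀, f₀, g₀, h₀, hf₀, hT₀, Y.prop_of_retract r' hy⟩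

end Covers

/-! ### Simple minded systems: regrouping the tower. -/

section Tower

variable {C : Type u} [Category.{v} C] [Preadditive C] [HasZeroObject C] [HasShift C ℤ]
  [∀ n : ℤ, (shiftFunctor C n).Additive] [Pretriangulated C] [IsTriangulated C]

instance (P : ObjectProperty C) [P.IsClosedUnderIsomorphisms] [P.IsStableUnderRetracts] (n : ℤ) :
    (shiftClass P n).IsStableUnderRetracts where
  of_retract r h := by
    rw [shiftClass_iff P (m := -n) (by lia)] at h ⊢
    exact P.prop_of_retract (r.map _) h

lemma negTower_one {P : ObjectProperty C} [P.IsClosedUnderIsomorphisms] : negTower P 1 = P := by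
  ext X
  constructor
  · rintro ⟨Y, Z, f, g, h, hT, hY, hZ⟩
    rw [Nat.cast_zero, neg_zero, shiftClass_zero] at hZ
    exact (prop_of_triangle_isZero₁ hT hY).2 hZ
  · intro hX
    refine ⟨0, X, 0, 𝟙 X, 0, contractible_distinguished₁ X, isZero_zero C, ?_⟩
    rwa [Nat.cast_zero, neg_zero, shiftClass_zero]

lemma negTower_succ_eq {P : ObjectProperty C} [P.IsClosedUnderIsomorphisms] (n : ℕ) :
    negTower P (n + 1) = P.extensionProduct (shiftClass (negTower P n) (-1)) := by
  induction n with
  | zero =>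
    rw [zero_add, negTower_one]
    ext X
    constructor
    · intro hX
      exact ⟨X, 0, 𝟙 X, 0, 0, contractible_distinguished X, hX, 0, isZero_zero C,
        ⟨(Functor.map_isZero _ (isZero_zero C)).iso (isZero_zero C)⟩⟩
    · rintro ⟨Y, Z, f, g, h, hT, hY, W, hW, ⟨e⟩⟩
      exact (prop_of_triangle_isZero₃ hT
        (((shiftFunctor C (-1 : ℤ)).map_isZero hW).of_iso e.symm)).1 hY
  | succ n ih =>
    change (negTower P (n + 1)).extensionProduct _ = P.extensionProduct
      (shiftClass ((negTower P n).extensionProduct (shiftClass P (-(n : ℤ)))) (-1))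
    rw [ih, shiftClass_extensionProduct, ObjectProperty.extensionProduct_assoc,
      shiftClass_shiftClass P (a := -(n : ℤ)) (b := -1) (c := -((n + 1 : ℕ) : ℤ)) (by lia)]

namespace IsOrthogonalCollection

variable {w : ℕ} (hw : 2 ≤ w) {ι : Type*} {s : ι → C} (hs : IsOrthogonalCollection w s)

include hs

/-- The layers of `Y` contribute the degrees `-1, …, -n`, all at least `-w+1`. -/
lemma homZero_negTower {n : ℕ} (hn : n + 1 ≤ w) {X Y : C} (hX : extClosure (.ofObj s) X)
    (hY : negTower (extClosure (.ofObj s)) n Y) : HomZero X Y (-1) := by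
  induction n generalizing Y with
  | zero => exact .of_isZero_right _ hY
  | succ n ih =>
    obtain ⟨A, B, f, g, h, hT, hA, Z, hZ, ⟨e⟩⟩ := hY
    refine HomZero.right₂ hT (ih (by lia) hA) (HomZero.of_iso ?_ (Iso.refl _) e)
    rw [HomZero.shift_right_iff rfl]
    exact hs.closure_homZero (by lia) (by lia) hX hZ

/-- The layers of `Y` contribute the degrees `-w+1, …, -w+n`, all at most `-1`. -/
lemma negTower_homZero {n : ℕ} (hn : n + 1 ≤ w) {X Y : C} (hX : extClosure (.ofObj s) X)
    (hY : negTower (extClosure (.ofObj s)) n Y) : HomZero Y X (-(w : ℤ) + 1) := by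
  induction n generalizing Y with
  | zero => exact .of_isZero_left _ hY
  | succ n ih =>
    obtain ⟨A, B, f, g, h, hT, hA, Z, hZ, ⟨e⟩⟩ := hY
    refine HomZero.left₂ hT (ih (by lia) hA) (HomZero.of_iso ?_ e (Iso.refl _))
    rw [HomZero.shift_left_iff (m := -(w : ℤ) + 1 + n) (by lia)]
    exact hs.closure_homZero (by lia) (by lia) hZ hX

lemma shiftClass_negTower_le {n : ℕ} (hn : n + 1 ≤ w) :
    shiftClass (negTower (extClosure (.ofObj s)) n) (-1) ≤
      (extClosure (.ofObj s)).rightOrthogonal := by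
  rintro X ⟨Y, hY, ⟨e⟩⟩
  rw [rightOrthogonal_iff_homZero]
  intro W hW
  refine HomZero.of_iso ?_ (Iso.refl _) e
  rw [HomZero.shift_right_iff (m := -1) (by lia)]
  exact hs.homZero_negTower hn hW hY

include hw

variable (k : Type*) [Field k] [Linear k C] [∀ X Y : C, Module.Finite k (X ⟶ Y)]

include k

lemma negTower_retract (n : ℕ) (hn : n ≤ w) :
    (negTower (extClosure (.ofObj s)) n).IsStableUnderRetracts := by
  induction n with
  | zero =>
    refine ⟨fun r hY => ?_⟩
    change IsZero _
    rw [IsZero.iff_id_eq_zero, ← r.retract, IsZero.eq_of_tgt hY r.i 0, zero_comp]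
  | succ n ih =>
    have := ih (by lia)
    refine ⟨fun r hY => ?_⟩
    rw [negTower_succ_eq] at hY ⊢
    obtain ⟨a, y, f, g, h, hf, hT, hy⟩ := exists_cover_triangle k (hs.isSemibrick hw).isAdmissible
      (hs.shiftClass_negTower_le hn) r hY
    exact ⟨a, y, f, g, h, hT, hf.mem, hy⟩

lemma rightOrthogonal_inf_negTower_le (I : Set ι) (n : ℕ) (hn : n + 1 ≤ w) :
    (subClosure s I).rightOrthogonal ⊓ negTower (extClosure (.ofObj s)) (n + 1) ≤
      (torsionFree s I).extensionProduct
        (shiftClass (negTower (extClosure (.ofObj s)) n) (-1)) := by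
  rintro X ⟨hX, hX'⟩
  have := hs.negTower_retract hw k n (by lia)
  rw [negTower_succ_eq] at hX'
  obtain ⟨a, y, f, g, h, hf, hT, hy⟩ := exists_cover_triangle k (hs.isSemibrick hw).isAdmissible
    (hs.shiftClass_negTower_le hn) (Retract.refl X) hX'
  refine ⟨a, y, f, g, h, hT, ⟨?_, hf.mem⟩, hy⟩
  obtain ⟨t, b, p, q, d, hT', ht, hb⟩ := (hs.isSemibrick hw).le_torsion_extensionProduct I _ hf.mem
  -- The torsion part `t` of the cover `a` dies in `X`, so `f` factors through `b = a / t`.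
  -- Factoring back through `f` gives an automorphism of `a` that kills `t`, so `a` is torsion-free.
  obtain ⟨φ, rfl⟩ := tri_desc₂ hT' f (hX _ ht)
  obtain ⟨σ, hσ⟩ := hf.factors b φ hb.2
  have := hf.right_minimal (q ≫ σ) (by rw [Category.assoc, hσ])
  have hp : p = 0 := by
    rw [← cancel_mono (q ≫ σ), reassoc_of% (tri_comp₁₂ hT'), zero_comp, zero_comp]
  intro Z ψ hZ
  obtain ⟨ψ', rfl⟩ := tri_lift₂ hT' ψ (hb.1 _ hZ)
  rw [hp, comp_zero]

end IsOrthogonalCollection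

/-- Each layer of the tower splits as `⟨S⟩ ⊆ T * F`; shifting the brackets by one place in `F *
Σ⁻¹(T * F) * ⋯ * Σ⁻ⁿ(T * F) * Σ⁻ⁿ⁻¹T` gives blocks `Σ⁻ⁱ(F * Σ⁻¹T)` with `F * Σ⁻¹T ⊆ ⟨L⟩`. -/
lemma IsLeftTilt.extensionProduct_le_negTower {ι : Type*} {s : ι → C} (hs : IsSemibrick s)
    {I : Set ι} {L : ι → C} (hL : IsLeftTilt s I L) (n : ℕ) :
    ((torsionFree s I).extensionProduct
      (shiftClass (negTower (extClosure (.ofObj s)) n) (-1))).extensionProduct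
        (shiftClass (subClosure s I) (-(n : ℤ) - 1)) ≤ negTower (extClosure (.ofObj L)) (n + 1) := by
  have h₁ : (torsionFree s I).extensionProduct (shiftClass (subClosure s I) (-1)) ≤
      extClosure (.ofObj L) :=
    (extensionProduct_mono (hL.torsionFree_le hs) hL.shiftClass_le).trans extClosure_ext
  induction n with
  | zero =>
    rw [zero_add, negTower_one]
    rintro X ⟨Y, Z, f, g, h, hT, ⟨A, B, f', g', h', hT', hA, W, hW, ⟨e⟩⟩, hZ⟩
    refine h₁ _ ⟨Y, Z, f, g, h, hT, ?_, by simpa using hZ⟩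
    exact (prop_of_triangle_isZero₃ hT'
      (((shiftFunctor C (-1 : ℤ)).map_isZero hW).of_iso e.symm)).1 hA
  | succ n ih =>
    change ((torsionFree s I).extensionProduct (shiftClass ((negTower _ n).extensionProduct
      (shiftClass _ (-(n : ℤ)))) (-1))).extensionProduct _ ≤
        (negTower (extClosure (.ofObj L)) (n + 1)).extensionProduct _
    have h₂ := shiftClass_mono (hs.le_torsion_extensionProduct I) (-((n + 1 : ℕ) : ℤ))
    have h₃ := shiftClass_mono h₁ (-((n + 1 : ℕ) : ℤ))
    rw [shiftClass_extensionProduct] at h₂ h₃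
    rw [shiftClass_shiftClass _ (c := -((n + 1 : ℕ) : ℤ) - 1) (by lia)] at h₃
    rw [shiftClass_extensionProduct, shiftClass_shiftClass _ (c := -((n + 1 : ℕ) : ℤ)) (by lia),
      ← ObjectProperty.extensionProduct_assoc]
    refine (ObjectProperty.monotone_extensionProduct_left _
      (ObjectProperty.monotone_extensionProduct_right _ h₂)).trans ?_
    rw [← ObjectProperty.extensionProduct_assoc, ObjectProperty.extensionProduct_assoc]
    refine extensionProduct_mono ?_ h₃
    refine le_trans ?_ ih
    rw [show -((n + 1 : ℕ) : ℤ) = -(n : ℤ) - 1 by lia]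

lemma IsSimpleMindedSystem.leftTilt {w : ℕ} (hw : 2 ≤ w) {k : Type*} [Field k] [Linear k C]
    [∀ X Y : C, Module.Finite k (X ⟶ Y)]
    (hCY : ∀ X Y : C, HomZero X Y 0 ↔ HomZero Y X (-(w : ℤ)))
    {ι : Type*} {s : ι → C} (hs : IsSimpleMindedSystem w s) {I : Set ι} {L : ι → C}
    (hL : IsLeftTilt s I L) : IsSimpleMindedSystem w L where
  isOrthogonalCollection := hs.isOrthogonalCollection.leftTilt hw hCY hL
  mem_negTower X := by
    have ho := hs.isOrthogonalCollection
    have hs' := ho.isSemibrick hw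
    obtain ⟨n, rfl⟩ : ∃ n, w = n + 1 := ⟨w - 1, by lia⟩
    let G : ObjectProperty C := (subClosure s I).leftOrthogonal ⊓ extClosure (.ofObj s)
    have hG : extClosure (.ofObj s) ≤ G.extensionProduct (subClosure s I) := by
      rintro Y ⟨m, hY⟩
      obtain ⟨g, t, a, b, c, hT, ht, hg, hg'⟩ := hs'.exists_cotorsion I hY
      exact ⟨g, t, a, b, c, hT, ⟨hg, hg'⟩, ht⟩
    have h₁ := shiftClass_mono hG (-(n : ℤ))
    rw [shiftClass_extensionProduct] at h₁
    -- The tower is applied to `Σ X` and its last factor is split as `G * T`. This isolates the end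
    -- factor `Σ⁻ʷT`; what precedes it must lie in `F * Σ⁻¹(⋯)`.
    have h₂ : shiftClass (negTower (extClosure (.ofObj s)) (n + 1)) (-1) X := by
      rw [shiftClass_iff _ (m := 1) (by lia)]
      exact hs.mem_negTower _
    replace h₂ := shiftClass_mono (ObjectProperty.monotone_extensionProduct_right _ h₁) (-1) _ h₂
    rw [← ObjectProperty.extensionProduct_assoc, shiftClass_extensionProduct,
      shiftClass_shiftClass (subClosure s I) (c := -(n : ℤ) - 1) (by lia)] at h₂
    refine hL.extensionProduct_le_negTower hs' n _
      (ObjectProperty.monotone_extensionProduct_left _ ?_ _ h₂)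
    rintro U ⟨V, hV, ⟨e⟩⟩
    refine ho.rightOrthogonal_inf_negTower_le hw k I n le_rfl _ ⟨?_, hs.mem_negTower U⟩
    rw [rightOrthogonal_iff_homZero]
    intro Y hY
    -- By duality `Hom(Y, U) = 0` becomes `Hom(V, Σ⁻ʷ⁺¹Y) = 0`. The first `w-1` layers of `V`
    -- satisfy this by orthogonality; for the last one, `Σ⁻ʷ⁺¹G`, the degree is `0` and `G` is left
    -- orthogonal to `Y`.
    rw [hCY]
    refine HomZero.of_iso ?_ e (Iso.refl _)
    rw [HomZero.shift_left_iff (m := -((n + 1 : ℕ) : ℤ) + 1) (by lia)]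
    obtain ⟨A, B, f, g, h, hT, hA, Z, hZ, ⟨e'⟩⟩ := hV
    refine HomZero.left₂ hT (ho.negTower_homZero le_rfl (subClosure_le I _ hY) hA)
      (HomZero.of_iso ?_ e' (Iso.refl _))
    rw [HomZero.shift_left_iff (m := 0) (by lia)]
    exact homZero_zero_iff.2 (fun f => hZ.1 f hY)

end Tower

end SimpleMinded

theorem mainTheorem3 {k : Type*} [Field k] {C : Type u} [Category.{v} C] [Preadditive C]
    [Linear k C] [HasZeroObject C] [HasShift C ℤ] [∀ n : ℤ, (shiftFunctor C n).Additive]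
    [∀ n : ℤ, (shiftFunctor C n).Linear k] [Pretriangulated C] [IsTriangulated C]
    [EssentiallySmall.{t} C] [∀ X Y : C, Module.Finite k (X ⟶ Y)] [IsIdempotentComplete C]
    (w : ℕ) (hw : 2 ≤ w) (hCY : SimpleMinded.IsCalabiYau k C (-(w : ℤ)))
    {ι : Type*} (s : ι → C) (hs : SimpleMinded.IsOrthogonalCollection w s)
    (I : Set ι) (hI : SimpleMinded.LeftTiltDefined s I)
    (S T F : ObjectProperty C)
    (hS : S = SimpleMinded.extClosure (ObjectProperty.ofObj s))
    (hT : T = SimpleMinded.subClosure s I)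
    (hF : F = T.rightOrthogonal ⊓ S) :
    (∃ L : ι → C, SimpleMinded.IsLeftTilt s I L) ∧
    (SimpleMinded.IsProperAbelian S ∧ SimpleMinded.IsTorsionPairIn S T F ∧
      (T.inverseImage S.ι).IsClosedUnderSubobjects) ∧
    ∀ (L : ι → C), SimpleMinded.IsLeftTilt s I L →
      ∀ (S₁ T₁ : ObjectProperty C),
        S₁ = SimpleMinded.extClosure (ObjectProperty.ofObj L) →
        T₁ = SimpleMinded.shiftClass T (-1) →
        SimpleMinded.IsOrthogonalCollection w L ∧
        (SimpleMinded.IsSimpleMindedSystem w s → SimpleMinded.IsSimpleMindedSystem w L) ∧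
        SimpleMinded.IsProperAbelian S₁ ∧ SimpleMinded.IsTorsionPairIn S₁ F T₁ ∧
        (T₁.inverseImage S₁.ι).IsClosedUnderQuotients := by
  subst hS hT hF
  have hs' := hs.isSemibrick hw
  refine ⟨hI.exists_leftTilt, ⟨hs'.isAdmissible.isProperAbelian, hs'.isTorsionPairIn I,
    hs'.isClosedUnderSubobjects I⟩, ?_⟩
  rintro L hL _ _ rfl rfl
  have hLo := hs.leftTilt hw hCY.homZero_iff hL
  have hL' := hLo.isSemibrick hw
  refine ⟨hLo, fun h => h.leftTilt hw (k := k) hCY.homZero_iff hL, hL'.isAdmissible.isProperAbelian,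
    hL.isTorsionPairIn hs' hL', ?_⟩
  rw [← hL.subClosure_eq]
  exact hL'.isClosedUnderQuotients I
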